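/- Let $n\ge 0$ and let $E$ be a finite-dimensional real vector space with a non-degenerate quadratic form $\mathbf q$ of signature $(2,n+1)$ and associated scalar product $\langle\cdot,\cdot\rangle$. Let $\mathbf H^{2,n}_+=\{x\in E: \mathbf q(x)=-1\}$, with the pseudo-Riemannian metric of signature $(2,n)$ induced by $\mathbf q$. Let $\mathbf P_+(E)=(E\setminus\{0\})/\mathbb R_{>0}$ be the space of rays, $\partial_\infty\mathbf H^{2,n}_+\subset \mathbf P_+(E)$ the set of isotropic rays, and $\overline{\mathbf H}{}^{2,n}_+=\mathbf H^{2,n}_+\cup\partial_\infty\mathbf H^{2,n}_+\subset\mathbf P_+(E)$. A pair of points of $\mathbf H^{2,n}_+$ is acausal if the geodesic through them is spacelike, that is, if they span a subspace of signature $(1,1)$; a surface is acausal if it is spacelike and any two distinct points of it form an acausal pair. A pointed hyperbolic plane $\mathsf P=(q,H)$ is given by a point $q\in\mathbf H^{2,n}_+$ and a positive definite $2$-plane $U\subset q^\perp$; $H$ is the connected component containing $q$ of $(\mathbb Rq\oplus U)\cap\mathbf H^{2,n}_+$. Let $W=U^\perp$, let $\mathbf D\subset U$ be the open unit disk and $\mathbf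 S^n\subset W$ the unit sphere of $-\mathbf q$. The map $$\Psi(u,w)=\frac{2}{1-\mathbf q(u)}\,u+\frac{1+\mathbf q(u)}{1-\mathbf q(u)}\,w$$ is a diffeomorphism $\mathbf D\times \mathbf S^n\to\mathbf H^{2,n}_+$, and the warped projection $\pi_{\mathsf P}:\mathbf H^{2,n}_+\to H$ is defined by $\pi_{\mathsf P}(\Psi(u,w))=\Psi(u,q)$. A timelike sphere is a set of the form $\pi_{\mathsf P}^{-1}(q)$ for some pointed hyperbolic plane $\mathsf P=(q,H)$. Let $S$ be a simply connected (in particular connected) smooth surface without boundary with a smooth spacelike immersion into $\mathbf H^{2,n}_+$ (i.e. the induced metric on $S$ is Riemannian). Say that $S$ is an entire graph if for every pointed hyperbolic plane $\mathsf P=(q,H)$ the restriction of $\pi_{\mathsf P}$ to $S$ is a diffeomorphism onto $H$. The asymptotic boundary $\partial_\infty S$ is the intersection with $\partial_\infty\mathbf H^{2,n}_+$ of the total boundary $\overline S\setminus S$, where $\overline S$ is the closure of $S$ in $\overline{\mathbf H}{}^{2,n}_+$. A semi-positive loop is a subset of $\overline{\mathbf H}{}^{2,n}_+$ homeomorphic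 to a circle that contains no triple of pairwise distinct points spanning a subspace of signature $(1,2)$, and contains at least one triple of pairwise distinct points spanning a subspace of signature $(2,1)$. Then: 1. If $S$ is properly immersed, or if its induced metric is complete, then $S$ is an entire graph. 2. If $S$ is an entire graph, then it is acausal. 3. If $S$ is an entire graph, then it intersects every timelike sphere exactly once. 4. If $S$ is an entire graph, then $\partial_\infty S$ is a semi-positive loop. -/

import Mathlib

open scoped Manifold ContDiff Topology

noncomputable section

namespace PseudoHyperbolic

variable {E : Type*} [NormedAddCommGroup E] [NormedSpace ℝ E]

/-! ### Signatures and the pseudo-hyperbolic space -/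

/-- The restriction of `Q` to the subspace `F` is non-degenerate of signature `(p, q)`. -/
def HasSignature (Q : QuadraticForm ℝ E) (F : Submodule ℝ E) (p q : ℕ) : Prop :=
  Module.finrank ℝ F = p + q ∧
    sigPos (Q.restrict F) = p ∧ sigNeg (Q.restrict F) = q

/-- The symmetric bilinear form `⟨x, y⟩` with `⟨x, x⟩ = Q x`. -/
def scal (Q : QuadraticForm ℝ E) : LinearMap.BilinForm ℝ E := QuadraticMap.associated Q

/-- The (double cover of the) pseudo-hyperbolic space, `{x ∈ E | Q x = -1}`. -/
def PseudoHyp (Q : QuadraticForm ℝ E) : Set E := {x | Q x = -1}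

/-- Two points of the pseudo-hyperbolic space form an acausal pair if the geodesic through them is
spacelike, i.e. if they span a subspace of signature `(1, 1)`. -/
def IsAcausalPair (Q : QuadraticForm ℝ E) (x y : PseudoHyp Q) : Prop :=
  HasSignature Q (Submodule.span ℝ {(x : E), (y : E)}) 1 1

/-- A subset is acausal if any two distinct points of it form an acausal pair. -/
def IsAcausalSet (Q : QuadraticForm ℝ E) (A : Set (PseudoHyp Q)) : Prop :=
  ∀ x ∈ A, ∀ y ∈ A, x ≠ y → IsAcausalPair Q x y

/-! ### Pointed hyperbolic planes and the warped projection -/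

/-- A pointed hyperbolic plane `(q, H)`, given by the corresponding orthogonal splitting
`E = ℝ q ⊕ U ⊕ V`, where `Q q = -1` and `U` is a positive definite plane. -/
structure PointedPlane (Q : QuadraticForm ℝ E) where
  q : E
  U : Submodule ℝ E
  q_mem : q ∈ PseudoHyp Q
  finrank_U : Module.finrank ℝ U = 2
  posDef_U : (Q.restrict U).PosDef
  ortho : ∀ u ∈ U, scal Q q u = 0

namespace PointedPlane

variable {Q : QuadraticForm ℝ E} (P : PointedPlane Q)

/-- The hyperbolic plane `H`: the sheet containing `q` of the two-sheeted hyperboloid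
`(ℝ q ⊕ U) ∩ {Q = -1}`. -/
def plane : Set E :=
  {x | x ∈ PseudoHyp Q ∧ x ∈ Submodule.span ℝ {P.q} ⊔ P.U ∧ scal Q x P.q < 0}

/-- The orthogonal complement `W = ℝ q ⊕ V` of `U`. -/
def W : Submodule ℝ E := (scal Q).orthogonal P.U

theorem nonneg_of_mem_U {u : E} (hu : u ∈ P.U) : 0 ≤ Q u :=
  P.posDef_U.nonneg ⟨u, hu⟩

variable [FiniteDimensional ℝ E]

theorem isCompl : IsCompl P.U P.W := by
  have hs : (scal Q).IsSymm := ⟨QuadraticMap.associated_isSymm ℝ Q⟩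
  refine LinearMap.BilinForm.isCompl_orthogonal_of_restrict_nondegenerate hs.isRefl ?_
  have hself : ∀ x : P.U, ((scal Q).restrict P.U) x x = Q.restrict P.U x := by
    intro x
    simp [scal, QuadraticMap.associated_eq_self_apply]
  refine ⟨fun x hx => ?_, fun x hx => ?_⟩ <;>
  · by_contra hne
    have := P.posDef_U x hne
    rw [← hself, hx x] at this
    exact lt_irrefl _ this

/-- The orthogonal projection of `E = U ⊕ W` onto `U`. -/
def projU : E →ₗ[ℝ] E := P.U.projection P.W P.isCompl

/-- The warped diffeomorphism `Ψ`, on the product of the open unit disk of `U` and the unit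
sphere of `W` (for `-Q`). -/
def warp (u w : E) : E :=
  (2 / (1 - Q u)) • u + ((1 + Q u) / (1 - Q u)) • w

/-- The first coordinate of the inverse of `Ψ`. -/
def diskCoord (x : E) : E := (1 + √(1 + Q (P.projU x)))⁻¹ • P.projU x

/-- The second coordinate of the inverse of `Ψ`. -/
def sphereCoord (x : E) : E := (√(1 + Q (P.projU x)))⁻¹ • (x - P.projU x)

/-- The warped projection, `Ψ (u, w) ↦ Ψ (u, q)`. -/
def warpedProj (x : E) : E := warp (Q := Q) (P.diskCoord x) P.q

theorem projU_mem (x : E) : P.projU x ∈ P.U := Submodule.projection_apply_mem P.isCompl x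

theorem diskCoord_warp {u w : E} (hu : u ∈ P.U) (hu1 : Q u < 1) (hw : w ∈ P.W) :
    P.diskCoord (warp (Q := Q) u w) = u := by
  have h0 := P.nonneg_of_mem_U hu
  have h1 : 0 < 1 - Q u := by linarith
  have hp : P.projU (warp (Q := Q) u w) = (2 / (1 - Q u)) • u := by
    simp only [warp, projU, map_add, map_smul]
    rw [(Submodule.projection_apply_eq_zero_iff P.isCompl).2 hw,
      (Submodule.projection_eq_self_iff P.isCompl u).2 hu]
    simp
  have hs : √(1 + Q (P.projU (warp (Q := Q) u w))) = (1 + Q u) / (1 - Q u) := by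
    rw [hp, QuadraticMap.map_smul, Real.sqrt_eq_iff_mul_self_eq (by positivity) (by positivity)]
    simp only [smul_eq_mul]
    field_simp
    ring
  rw [diskCoord, hs, hp, smul_smul]
  have : (1 + (1 + Q u) / (1 - Q u))⁻¹ * (2 / (1 - Q u)) = 1 := by
    field_simp
    ring
  rw [this, one_smul]

/-- The coordinates `diskCoord`, `sphereCoord` do invert `Ψ` on the pseudo-hyperbolic space. -/
theorem warp_coord (x : E) :
    warp (Q := Q) (P.diskCoord x) (P.sphereCoord x) = x := by
  have h0 := P.nonneg_of_mem_U (P.projU_mem x)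
  set a := Q (P.projU x) with ha
  set s := √(1 + a) with hs
  have hs2 : s * s = 1 + a := Real.mul_self_sqrt (by positivity)
  have hs0 : 0 < s := Real.sqrt_pos.2 (by positivity)
  have hr : Q (P.diskCoord x) = (s - 1) / (1 + s) := by
    rw [diskCoord, QuadraticMap.map_smul, ← ha, ← hs]
    have : a = (s - 1) * (s + 1) := by linarith
    rw [this]
    simp only [smul_eq_mul]
    field_simp
    ring
  have h1 : 1 - (s - 1) / (1 + s) = 2 / (1 + s) := by field_simp; ring
  have h2 : 1 + (s - 1) / (1 + s) = 2 * s / (1 + s) := by field_simp; ring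
  rw [warp, hr, h1, h2, diskCoord, sphereCoord, ← ha, ← hs, smul_smul, smul_smul]
  have e1 : 2 / (2 / (1 + s)) * (1 + s)⁻¹ = 1 := by field_simp
  have e2 : 2 * s / (1 + s) / (2 / (1 + s)) * s⁻¹ = 1 := by field_simp
  rw [e1, e2]
  module

end PointedPlane

variable [FiniteDimensional ℝ E]

/-- A timelike sphere: a fiber of the warped projection of some pointed hyperbolic plane `(q, H)`
above the base point `q`. -/
def IsTimelikeSphere (Q : QuadraticForm ℝ E) (A : Set (PseudoHyp Q)) : Prop :=
  ∃ P : PointedPlane Q, A = {x : PseudoHyp Q | P.warpedProj (x : E) = P.q}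

/-! ### The compactification and semi-positive loops -/

/-- The quotient topology on the space of rays of `E`. -/
instance rayTopology : TopologicalSpace (Module.Ray ℝ E) :=
  TopologicalSpace.coinduced (fun v : {v : E // v ≠ 0} => rayOfNeZero ℝ v.1 v.2) inferInstance

/-- The ray spanned by a point of the pseudo-hyperbolic space. -/
def toRay (Q : QuadraticForm ℝ E) (x : PseudoHyp Q) : Module.Ray ℝ E :=
  rayOfNeZero ℝ (x : E) (by
    intro h
    have hx : Q (x : E) = -1 := x.2
    rw [h, QuadraticMap.map_zero] at hx
    norm_num at hx)

/-- The boundary at infinity: the set of isotropic rays. -/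
def infinity (Q : QuadraticForm ℝ E) : Set (Module.Ray ℝ E) :=
  {r | ∃ (v : E) (hv : v ≠ 0), Q v = 0 ∧ r = rayOfNeZero ℝ v hv}

/-- The compactification of the pseudo-hyperbolic space, inside the space of rays. -/
def compactification (Q : QuadraticForm ℝ E) : Set (Module.Ray ℝ E) :=
  Set.range (toRay Q) ∪ infinity Q

/-- The linear span of a set of rays. -/
def raySpan (A : Set (Module.Ray ℝ E)) : Submodule ℝ E :=
  Submodule.span ℝ {v | ∃ hv : v ≠ 0, rayOfNeZero ℝ v hv ∈ A}

/-- A triple of pairwise distinct points is positive if it spans a space of signature `(2, 1)`. -/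
def IsPositiveTriple (Q : QuadraticForm ℝ E) (a b c : Module.Ray ℝ E) : Prop :=
  a ≠ b ∧ a ≠ c ∧ b ≠ c ∧ HasSignature Q (raySpan {a, b, c}) 2 1

/-- A triple of pairwise distinct points is negative if it spans a space of signature `(1, 2)`. -/
def IsNegativeTriple (Q : QuadraticForm ℝ E) (a b c : Module.Ray ℝ E) : Prop :=
  a ≠ b ∧ a ≠ c ∧ b ≠ c ∧ HasSignature Q (raySpan {a, b, c}) 1 2

/-- A semi-positive loop: a topological circle in the compactification which contains no negative
triple and at least one positive triple. -/
def IsSemiPositiveLoop (Q : QuadraticForm ℝ E) (L : Set (Module.Ray ℝ E)) : Prop :=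
  L ⊆ compactification Q ∧ Nonempty (L ≃ₜ Circle) ∧
    (¬ ∃ a ∈ L, ∃ b ∈ L, ∃ c ∈ L, IsNegativeTriple Q a b c) ∧
    ∃ a ∈ L, ∃ b ∈ L, ∃ c ∈ L, IsPositiveTriple Q a b c

/-- The total boundary of (the image `A` of) a surface without boundary: its closure in the
compactification, minus the surface itself. -/
def totalBoundary (Q : QuadraticForm ℝ E) (A : Set (PseudoHyp Q)) : Set (Module.Ray ℝ E) :=
  (closure (toRay Q '' A) ∩ compactification Q) \ (toRay Q '' A)

/-- The asymptotic boundary: the part of the total boundary lying at infinity. -/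
def asymptoticBoundary (Q : QuadraticForm ℝ E) (A : Set (PseudoHyp Q)) :
    Set (Module.Ray ℝ E) :=
  totalBoundary Q A ∩ infinity Q

/-! ### Spacelike surfaces -/

section Surface

variable {S : Type*} [TopologicalSpace S] [ChartedSpace (EuclideanSpace ℝ (Fin 2)) S]

/-- The first fundamental form `v ↦ Q (df_s v)` of a map `f` from a surface to the
pseudo-hyperbolic space. -/
def firstForm (Q : QuadraticForm ℝ E) (f : S → PseudoHyp Q) (s : S)
    (v : TangentSpace (𝓡 2) s) : ℝ :=
  Q (mfderiv (𝓡 2) 𝓘(ℝ, E) (fun t => (f t : E)) s v : E)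

/-- A smooth map from a surface to the pseudo-hyperbolic space whose first fundamental form is
positive definite (so that it is an immersion, with spacelike image). -/
def IsSpacelikeImmersion (Q : QuadraticForm ℝ E) (f : S → PseudoHyp Q) : Prop :=
  ContMDiff (𝓡 2) 𝓘(ℝ, E) ∞ (fun s => (f s : E)) ∧
    ∀ (s : S) (v : TangentSpace (𝓡 2) s), v ≠ 0 → 0 < firstForm Q f s v

/-- The distance of the metric induced on the surface: the infimum of the lengths of `C^1` paths,
where the length of a tangent vector is the square root of the first fundamental form. -/
def inducedEDist (Q : QuadraticForm ℝ E) (f : S → PseudoHyp Q) (x y : S) : ENNReal :=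
  letI : ∀ s : S, ENorm (TangentSpace (𝓡 2) s) :=
    fun s => ⟨fun v => ENNReal.ofReal √(firstForm Q f s v)⟩
  Manifold.riemannianEDist (𝓡 2) x y

/-- The induced metric is complete: every Cauchy sequence converges. -/
def IsCompleteInduced (Q : QuadraticForm ℝ E) (f : S → PseudoHyp Q) : Prop :=
  ∀ a : ℕ → S,
    (∀ ε : ENNReal, 0 < ε → ∃ N, ∀ k ≥ N, ∀ l ≥ N, inducedEDist Q f (a k) (a l) < ε) →
    ∃ x : S, Filter.Tendsto (fun k => inducedEDist Q f (a k) x) Filter.atTop (𝓝 0)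

/-- `φ` is a diffeomorphism of the surface `S` onto the embedded submanifold `N` of `E`. -/
def IsDiffeoOnto (φ : S → E) (N : Set E) : Prop :=
  ContMDiff (𝓡 2) 𝓘(ℝ, E) ∞ φ ∧ (∀ s, φ s ∈ N) ∧
    ∃ ψ : E → S, ContMDiffOn 𝓘(ℝ, E) (𝓡 2) ∞ ψ N ∧ (∀ s, ψ (φ s) = s) ∧
      ∀ x ∈ N, φ (ψ x) = x

/-- The surface is an entire graph: for every pointed hyperbolic plane `(q, H)`, the warped
projection restricts to a diffeomorphism of the surface onto `H`. -/
def IsEntireGraph (Q : QuadraticForm ℝ E) (f : S → PseudoHyp Q) : Prop :=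
  ∀ P : PointedPlane Q, IsDiffeoOnto (fun s => P.warpedProj (f s : E)) P.plane

end Surface

end PseudoHyperbolic

end

noncomputable section

namespace PseudoHyperbolic

/-! ### Quadratic forms and signatures -/

section Signature

/-! A pointed plane `P` splits `E = U ⊕ W`, with `W` negative definite. In orthonormal coordinates
`Q` is the square norm of the `U`-part minus that of the `W`-part, and the warped projection is
`projU` followed by the parametrization of `H` as a graph over `U`.

Entire graph. The `U`-component `A` satisfies `Q x ≤ ‖A x‖ ^ 2`, so on a spacelike surface `A ∘ f`
is a local diffeomorphism that does not decrease lengths. A partial lift of a segment therefore has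
bounded induced length, and it converges if the metric is complete. If `f` is proper, the lift stays
in a compact set, because `Q = -1` bounds the `W`-part by the `U`-part. A local homeomorphism from a
connected Hausdorff space to a vector space along which segments lift is bijective
(`bijective_of_lifts`).

Acausality. For an entire graph, projection to every positive definite plane is injective. If `|⟨x,
y⟩| < 1`, then `x` and `y` span a negative definite plane, which some projection kills. If `⟨f s, f
t⟩ = ±1` with `s ≠ t`, then `s` is a local extremum of `⟨f t, ·⟩`, so projection to the tangent
plane at `s` kills both points. Hence `⟨f s, f t⟩ ^ 2 > 1` (`ProjInjective.one_lt_scal_sq`), and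
connectedness improves this to `⟨f s, f t⟩ ≤ -1`. Timelike spheres are fibers of a bijection.

Boundary. Rescale `f s` so that its `W`-part is a unit vector. The inequality `⟨f s, f t⟩ ≤ -1`
passes to the closure and makes it a graph over the closed disk (`eq_of_fst_eq`, `exists_mem_hull`).
Its isotropic part is a graph over the circle, with all pairwise products nonpositive, which
excludes negative triples. Without a positive triple, nearby boundary points would be mutually
orthogonal. Equally spaced points would then satisfy the recurrence of the cosine and sum to zero
around the circle, although some `f s` has nonpositive product with all of them and a negative one
with the first (`exists_scal_neg_triple`). -/

theorem le_sigPos_of_forall_pos {M N : Type*} [AddCommGroup M] [Module ℝ M]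
    [FiniteDimensional ℝ M] [AddCommGroup N] [Module ℝ N]
    {q : QuadraticForm ℝ M} (T : N →ₗ[ℝ] M) (hT : ∀ x, x ≠ 0 → 0 < q (T x)) :
    Module.finrank ℝ N ≤ sigPos q := by
  have hinj : Function.Injective T := by
    rw [injective_iff_map_eq_zero]
    intro x hx
    by_contra hne
    have := hT x hne
    rw [hx, QuadraticMap.map_zero] at this
    exact lt_irrefl _ this
  have hV : (q.restrict (LinearMap.range T)).PosDef := by
    rintro ⟨y, x, rfl⟩ hy
    refine hT x ?_
    rintro rfl
    exact hy (Subtype.ext (map_zero T))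
  rw [← LinearMap.finrank_range_of_inj hinj]
  exact le_sigPos_of_posDef q hV

theorem le_sigNeg_of_forall_neg {M N : Type*} [AddCommGroup M] [Module ℝ M]
    [FiniteDimensional ℝ M] [AddCommGroup N] [Module ℝ N]
    {q : QuadraticForm ℝ M} (T : N →ₗ[ℝ] M) (hT : ∀ x, x ≠ 0 → q (T x) < 0) :
    Module.finrank ℝ N ≤ sigNeg q := by
  rw [← sigPos_neg]
  exact le_sigPos_of_forall_pos T fun x hx => by simpa using hT x hx

theorem finrank_add_sigNeg_le_of_nonneg {M : Type*} [AddCommGroup M] [Module ℝ M]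
    [FiniteDimensional ℝ M] {q : QuadraticForm ℝ M} {V : Submodule ℝ M}
    (hV : ∀ x ∈ V, 0 ≤ q x) : Module.finrank ℝ V + sigNeg q ≤ Module.finrank ℝ M := by
  have := QuadraticForm.sigPos_add_finrank_le_of_nonpos (Q := -q) (V := V)
    (fun x hx => by simpa using hV x hx)
  rw [sigPos_neg] at this
  omega

/-- A positive definite form has an orthonormal coordinate system. -/
theorem exists_coord_of_posDef {M : Type*} [AddCommGroup M] [Module ℝ M]
    [FiniteDimensional ℝ M] {q : QuadraticForm ℝ M} (hq : q.PosDef) {k : ℕ}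
    (hk : Module.finrank ℝ M = k) :
    ∃ e : M ≃ₗ[ℝ] EuclideanSpace ℝ (Fin k), ∀ x, q x = ‖e x‖ ^ 2 := by
  let c : InnerProductSpace.Core ℝ M :=
    { inner := fun x y => QuadraticMap.associated (R := ℝ) q x y
      conj_inner_symm := fun x y => by
        simpa using QuadraticMap.associated_isSymm ℝ q y x
      re_inner_nonneg := fun x => by
        simpa [QuadraticMap.associated_eq_self_apply] using hq.nonneg x
      add_left := fun x y z => by simp
      smul_left := fun x y r => by simp
      definite := fun x hx => by
        by_contra hne
        have h := hq x hne
        rw [QuadraticMap.associated_eq_self_apply] at hx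
        exact h.ne' hx }
  let : NormedAddCommGroup M := c.toNormedAddCommGroup
  let : InnerProductSpace ℝ M := InnerProductSpace.ofCore c.toCore
  refine ⟨((stdOrthonormalBasis ℝ M).reindex (finCongr hk)).repr.toLinearEquiv, fun x => ?_⟩
  have h1 : ‖((stdOrthonormalBasis ℝ M).reindex (finCongr hk)).repr x‖ = ‖x‖ :=
    LinearIsometryEquiv.norm_map _ _
  have h2 : inner ℝ x x = ‖x‖ ^ 2 := real_inner_self_eq_norm_sq x
  have h3 : inner ℝ x x = q x := QuadraticMap.associated_eq_self_apply ℝ q x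
  change q x = ‖((stdOrthonormalBasis ℝ M).reindex (finCongr hk)).repr x‖ ^ 2
  rw [h1, ← h2, h3]

end Signature

variable {E : Type*} [NormedAddCommGroup E] [NormedSpace ℝ E]

/-! ### Polarization identities and continuity of the scalar product. -/

section Scal

variable (Q : QuadraticForm ℝ E)

theorem scal_self (x : E) : scal Q x x = Q x := QuadraticMap.associated_eq_self_apply ℝ Q x

theorem scal_comm (x y : E) : scal Q x y = scal Q y x := by
  exact QuadraticMap.associated_isSymm ℝ Q x y

theorem map_add_eq (x y : E) : Q (x + y) = Q x + 2 * scal Q x y + Q y := by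
  rw [← scal_self, ← scal_self Q x, ← scal_self Q y]
  simp only [map_add, LinearMap.add_apply]
  rw [scal_comm Q y x]; ring

theorem map_sub_eq (x y : E) : Q (x - y) = Q x - 2 * scal Q x y + Q y := by
  rw [sub_eq_add_neg, map_add_eq, map_neg, QuadraticMap.map_neg]; ring

theorem map_smul_eq (c : ℝ) (x : E) : Q (c • x) = c ^ 2 * Q x := by
  rw [QuadraticMap.map_smul, smul_eq_mul, sq]

theorem map_smul_add_smul (a b : ℝ) (x y : E) :
    Q (a • x + b • y) = a ^ 2 * Q x + 2 * (a * b) * scal Q x y + b ^ 2 * Q y := by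
  rw [map_add_eq, map_smul_eq, map_smul_eq]
  simp only [map_smul, LinearMap.smul_apply, smul_eq_mul]
  ring

variable [FiniteDimensional ℝ E]

/-- The scalar product as a continuous bilinear map. -/
def scalL : E →L[ℝ] E →L[ℝ] ℝ := LinearMap.toContinuousBilinearMap (scal Q)

theorem scalL_apply (x y : E) : scalL Q x y = scal Q x y := rfl

theorem contDiff_form {n : ℕ∞ω} : ContDiff ℝ n (fun x => Q x) := by
  have h : (fun x => Q x) = fun x => scalL Q x x := funext fun x => (scal_self Q x).symm
  rw [h]
  exact (scalL Q).contDiff.clm_apply contDiff_id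

theorem continuous_form : Continuous fun x => Q x := (contDiff_form Q (n := 0)).continuous

variable {Q} in
theorem continuous_scal {X : Type*} [TopologicalSpace X] {g h : X → E} (hg : Continuous g)
    (hh : Continuous h) : Continuous fun x => scal Q (g x) (h x) :=
  ((scalL Q).continuous.comp hg).clm_apply hh

end Scal

section HasSignature

variable [FiniteDimensional ℝ E] {Q : QuadraticForm ℝ E}

/-- Lower bounds for both indices and an upper bound for the dimension suffice: since the two
indices and the dimension of the radical add up to the dimension, all these inequalities are
equalities. -/
theorem hasSignature_of_forall {F : Submodule ℝ E} {p q : ℕ}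
    {N N' : Type*} [AddCommGroup N] [Module ℝ N] [AddCommGroup N'] [Module ℝ N']
    (hF : Module.finrank ℝ F ≤ p + q)
    (T : N →ₗ[ℝ] E) (hT : ∀ x, T x ∈ F) (hN : Module.finrank ℝ N = p)
    (hp : ∀ x, x ≠ 0 → 0 < Q (T x))
    (T' : N' →ₗ[ℝ] E) (hT' : ∀ x, T' x ∈ F) (hN' : Module.finrank ℝ N' = q)
    (hn : ∀ x, x ≠ 0 → Q (T' x) < 0) :
    HasSignature Q F p q := by
  have h1 : p ≤ sigPos (Q.restrict F) := by
    rw [← hN]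
    exact le_sigPos_of_forall_pos (T.codRestrict F hT) hp
  have h2 : q ≤ sigNeg (Q.restrict F) := by
    rw [← hN']
    exact le_sigNeg_of_forall_neg (T'.codRestrict F hT') hn
  have h3 := QuadraticForm.sigPos_add_sigNeg_add_radical (Q := Q.restrict F)
  refine ⟨?_, ?_, ?_⟩ <;> omega

theorem HasSignature.finrank_le_of_nonneg {F V : Submodule ℝ E} {p q : ℕ}
    (h : HasSignature Q F p q) (hVF : V ≤ F) (hV : ∀ x ∈ V, 0 ≤ Q x) :
    Module.finrank ℝ V ≤ p := by
  have h1 := finrank_add_sigNeg_le_of_nonneg (q := Q.restrict F) (V := V.submoduleOf F)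
    (fun x hx => hV x hx)
  rw [h.1, h.2.2, (Submodule.submoduleOfEquivOfLe hVF).finrank_eq] at h1
  omega

end HasSignature

/-! ### The splitting defined by a pointed plane, and the warped projection as a linear projection.
-/

namespace PointedPlane

variable {Q : QuadraticForm ℝ E} (P : PointedPlane Q)

theorem mem_W {x : E} : x ∈ P.W ↔ ∀ u ∈ P.U, scal Q u x = 0 := Iff.rfl

theorem q_mem_W : P.q ∈ P.W := P.mem_W.2 fun u hu => by rw [scal_comm]; exact P.ortho u hu

theorem scal_eq_zero {u w : E} (hu : u ∈ P.U) (hw : w ∈ P.W) : scal Q u w = 0 := hw u hu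

theorem pos_of_mem_U {u : E} (hu : u ∈ P.U) (h : u ≠ 0) : 0 < Q u :=
  P.posDef_U ⟨u, hu⟩ (fun h' => h (congrArg Subtype.val h'))

theorem q_mem_plane : P.q ∈ P.plane := by
  refine ⟨P.q_mem, Submodule.mem_sup_left (Submodule.mem_span_singleton_self _), ?_⟩
  rw [scal_self, show Q P.q = -1 from P.q_mem]
  norm_num

/-- The plane `H` is the graph of `u ↦ √(1 + Q u)` over `U`. -/
theorem mem_plane_iff {x : E} :
    x ∈ P.plane ↔ ∃ u ∈ P.U, x = u + √(1 + Q u) • P.q := by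
  have hq : Q P.q = -1 := P.q_mem
  constructor
  · rintro ⟨h1, h2, h3⟩
    obtain ⟨y, hy, u, hu, rfl⟩ := Submodule.mem_sup.1 h2
    obtain ⟨c, rfl⟩ := Submodule.mem_span_singleton.1 hy
    refine ⟨u, hu, ?_⟩
    have h1' : Q (c • P.q + u) = -1 := h1
    rw [map_add_eq, map_smul_eq, map_smul, LinearMap.smul_apply, P.ortho u hu, hq] at h1'
    simp only [map_add, map_smul, LinearMap.add_apply, LinearMap.smul_apply, scal_self, hq] at h3
    rw [scal_comm, P.ortho u hu] at h3
    have : √(1 + Q u) = c := by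
      rw [Real.sqrt_eq_iff_mul_self_eq]
      · simp at h1'; linarith
      · have := P.nonneg_of_mem_U hu; linarith
      · simp at h3; linarith
    rw [this, add_comm]
  · rintro ⟨u, hu, rfl⟩
    have h0 := P.nonneg_of_mem_U hu
    have hs2 : √(1 + Q u) ^ 2 = 1 + Q u := Real.sq_sqrt (by positivity)
    have hs0 : 0 < √(1 + Q u) := Real.sqrt_pos.2 (by positivity)
    have hort : scal Q u P.q = 0 := by rw [scal_comm]; exact P.ortho u hu
    refine ⟨?_, ?_, ?_⟩
    · change Q _ = -1
      rw [map_add_eq, map_smul_eq, map_smul, hort, hq, hs2]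
      simp
    · rw [add_comm]
      exact Submodule.add_mem_sup (Submodule.smul_mem _ _ (Submodule.mem_span_singleton_self _)) hu
    · simp only [map_add, map_smul, LinearMap.add_apply, LinearMap.smul_apply, scal_self, hq, hort]
      simpa using hs0

variable [FiniteDimensional ℝ E]

theorem projU_of_mem_U {u : E} (hu : u ∈ P.U) : P.projU u = u :=
  (Submodule.projection_eq_self_iff P.isCompl u).2 hu

theorem projU_eq_zero_iff {w : E} : P.projU w = 0 ↔ w ∈ P.W :=
  Submodule.projection_apply_eq_zero_iff P.isCompl

theorem sub_projU_mem (x : E) : x - P.projU x ∈ P.W := by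
  rw [← P.projU_eq_zero_iff, map_sub, P.projU_of_mem_U (P.projU_mem x), sub_self]

theorem map_eq_projU_add (x : E) : Q x = Q (P.projU x) + Q (x - P.projU x) := by
  conv_lhs => rw [← add_sub_cancel (P.projU x) x]
  rw [map_add_eq, P.scal_eq_zero (P.projU_mem x) (P.sub_projU_mem x)]
  ring

variable {n : ℕ}

/-- Otherwise `U ⊕ ℝ w` would be a three-dimensional subspace on which `Q` is nonnegative, whereas
the signature allows dimension two at most. -/
theorem neg_of_mem_W (hQ : HasSignature Q ⊤ 2 (n + 1)) {w : E} (hw : w ∈ P.W) (h : w ≠ 0) :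
    Q w < 0 := by
  by_contra! hpos
  have hdisj : Disjoint P.U (ℝ ∙ w) :=
    P.isCompl.disjoint.mono_right (by simpa [Submodule.span_le] using hw)
  have h3 : Module.finrank ℝ (P.U ⊔ (ℝ ∙ w) : Submodule ℝ E) = 3 := by
    have := Submodule.finrank_sup_add_finrank_inf_eq P.U (ℝ ∙ w)
    rw [hdisj.eq_bot, finrank_bot, P.finrank_U, finrank_span_singleton h] at this
    omega
  have h2 := hQ.finrank_le_of_nonneg (V := P.U ⊔ (ℝ ∙ w)) le_top (fun x hx => by
    obtain ⟨u, hu, y, hy, rfl⟩ := Submodule.mem_sup.1 hx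
    obtain ⟨c, rfl⟩ := Submodule.mem_span_singleton.1 hy
    rw [map_add_eq, P.scal_eq_zero hu (P.W.smul_mem c hw), map_smul_eq]
    have := P.nonneg_of_mem_U hu
    positivity)
  omega

theorem finrank_W (hQ : HasSignature Q ⊤ 2 (n + 1)) : Module.finrank ℝ P.W = n + 1 := by
  have h1 := Submodule.finrank_add_eq_of_isCompl P.isCompl
  have h2 := hQ.1
  rw [finrank_top] at h2
  rw [P.finrank_U] at h1
  omega

/-- Orthonormal coordinates adapted to the splitting `E = U ⊕ W`. -/
theorem exists_coord (hQ : HasSignature Q ⊤ 2 (n + 1)) :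
    ∃ L : E ≃L[ℝ] EuclideanSpace ℝ (Fin 2) × EuclideanSpace ℝ (Fin (n + 1)),
      (∀ x, Q x = ‖(L x).1‖ ^ 2 - ‖(L x).2‖ ^ 2) ∧
        ∀ x, P.projU x = L.symm ((L x).1, 0) := by
  obtain ⟨e, he⟩ := exists_coord_of_posDef P.posDef_U P.finrank_U
  have hneg : ((-Q).restrict P.W).PosDef := by
    rintro ⟨w, hw⟩ hne
    have := P.neg_of_mem_W hQ hw (fun h => hne (Subtype.ext h))
    simpa using this
  obtain ⟨e', he'⟩ := exists_coord_of_posDef hneg (P.finrank_W hQ)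
  let L0 := (Submodule.prodEquivOfIsCompl _ _ P.isCompl).symm ≪≫ₗ e.prodCongr e'
  have hL0 (u : P.U) (w : P.W) : L0 (u + w : E) = (e u, e' w) := by
    have : ((u : E) + w) = Submodule.prodEquivOfIsCompl _ _ P.isCompl (u, w) := rfl
    rw [this]
    simp only [L0, LinearEquiv.trans_apply, LinearEquiv.symm_apply_apply]
    rfl
  have hx (x : E) : L0 x = (e ⟨_, P.projU_mem x⟩, e' ⟨_, P.sub_projU_mem x⟩) := by
    rw [← hL0]; simp
  refine ⟨L0.toContinuousLinearEquiv, fun x => ?_, fun x => ?_⟩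
  · change Q x = ‖(L0 x).1‖ ^ 2 - ‖(L0 x).2‖ ^ 2
    rw [hx, ← he, ← he', P.map_eq_projU_add]
    simp
  · change P.projU x = L0.symm ((L0 x).1, 0)
    rw [LinearEquiv.eq_symm_apply]
    have := hL0 ⟨_, P.projU_mem x⟩ 0
    simp only [ZeroMemClass.coe_zero, add_zero, map_zero] at this
    rw [this, hx]

/-- The warped projection in terms of the linear projection onto `U`. -/
theorem warpedProj_eq (x : E) :
    P.warpedProj x = P.projU x + √(1 + Q (P.projU x)) • P.q := by
  have h0 := P.nonneg_of_mem_U (P.projU_mem x)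
  have hs2 : √(1 + Q (P.projU x)) * √(1 + Q (P.projU x)) = 1 + Q (P.projU x) :=
    Real.mul_self_sqrt (by positivity)
  have hs0 : 0 < √(1 + Q (P.projU x)) := Real.sqrt_pos.2 (by positivity)
  have hd : P.diskCoord x = (1 + √(1 + Q (P.projU x)))⁻¹ • P.projU x := rfl
  rw [warpedProj, warp, hd]
  generalize √(1 + Q (P.projU x)) = s at *
  have ha : Q (P.projU x) = s * s - 1 := by linarith
  rw [map_smul_eq, ha, smul_smul]
  congr 2
  · have : 1 - (1 + s)⁻¹ ^ 2 * (s * s - 1) = 2 / (1 + s) := by field_simp; ring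
    rw [this]; field_simp; simp
  · have h1 : 1 - (1 + s)⁻¹ ^ 2 * (s * s - 1) = 2 / (1 + s) := by field_simp; ring
    have h2 : 1 + (1 + s)⁻¹ ^ 2 * (s * s - 1) = 2 * s / (1 + s) := by field_simp; ring
    rw [h1, h2]; field_simp

theorem projU_q : P.projU P.q = 0 := P.projU_eq_zero_iff.2 P.q_mem_W

theorem projU_warpedProj (x : E) : P.projU (P.warpedProj x) = P.projU x := by
  rw [warpedProj_eq, map_add, map_smul, projU_q, P.projU_of_mem_U (P.projU_mem x), smul_zero,
    add_zero]

theorem warpedProj_eq_iff {x y : E} : P.warpedProj x = P.warpedProj y ↔ P.projU x = P.projU y := by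
  refine ⟨fun h => ?_, fun h => by rw [warpedProj_eq, warpedProj_eq, h]⟩
  rw [← projU_warpedProj, h, projU_warpedProj]

end PointedPlane

end PseudoHyperbolic
end

noncomputable section

namespace PseudoHyperbolic

/-! ### Local structure of spacelike surfaces -/

/-- The model plane. -/
abbrev R2 := EuclideanSpace ℝ (Fin 2)

variable {E : Type*} [NormedAddCommGroup E] [NormedSpace ℝ E]
  {S : Type*} [TopologicalSpace S] [ChartedSpace (EuclideanSpace ℝ (Fin 2)) S]

/-- A local parametrization of a spacelike surface. -/
structure LocalParam (Q : QuadraticForm ℝ E) (f : S → PseudoHyp Q) (s : S) where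
  chart : OpenPartialHomeomorph S R2
  mem_source : s ∈ chart.source
  contMDiffOn_symm : ContMDiffOn 𝓘(ℝ, R2) (𝓡 2) ∞ chart.symm chart.target
  contDiffAt : ∀ y ∈ chart.target, ContDiffAt ℝ ∞ (fun z => (f (chart.symm z) : E)) y
  pos : ∀ y ∈ chart.target, ∀ ξ : R2, ξ ≠ 0 →
    0 < Q (fderiv ℝ (fun z => (f (chart.symm z) : E)) y ξ)

variable {Q : QuadraticForm ℝ E} {f : S → PseudoHyp Q}

theorem IsSpacelikeImmersion.exists_localParam [IsManifold (𝓡 2) ∞ S]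
    (hf : IsSpacelikeImmersion Q f) (s : S) : Nonempty (LocalParam Q f s) := by
  let c := chartAt R2 s
  have hsymm : ContMDiffOn 𝓘(ℝ, R2) (𝓡 2) ∞ c.symm c.target := contMDiffOn_chart_symm
  have hmd := mdifferentiable_chart (I := 𝓡 2) s
  refine ⟨⟨c, mem_chart_source _ s, hsymm, fun y hy => ?_, fun y hy ξ hξ => ?_⟩⟩
  · have h1 := (hf.1.contMDiffAt (x := c.symm y)).comp y
      ((hsymm y hy).contMDiffAt (c.open_target.mem_nhds hy))
    exact h1.contDiffAt
  · have h1 : MDifferentiableAt (𝓡 2) 𝓘(ℝ, E) (fun t => (f t : E)) (c.symm y) :=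
      (hf.1.contMDiffAt (x := c.symm y)).mdifferentiableAt (by simp)
    have h2 : MDifferentiableAt 𝓘(ℝ, R2) (𝓡 2) c.symm y := hmd.mdifferentiableAt_symm hy
    have h3 := mfderiv_comp y h1 h2
    rw [mfderiv_eq_fderiv] at h3
    have h4 : mfderiv 𝓘(ℝ, R2) (𝓡 2) c.symm y ξ ≠ 0 := by
      have := hmd.symm.mfderiv_injective (x := y) hy
      intro h0
      exact hξ (this (h0.trans (map_zero _).symm))
    have h5 := hf.2 _ _ h4
    have h6 : fderiv ℝ (fun z => (f (c.symm z) : E)) y ξ =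
      mfderiv (𝓡 2) 𝓘(ℝ, E) (fun t => (f t : E)) (c.symm y)
        (mfderiv 𝓘(ℝ, R2) (𝓡 2) c.symm y ξ) := congrArg (fun T => T ξ) h3
    rw [h6]
    exact h5

namespace LocalParam

variable {s : S} (p : LocalParam Q f s)

/-- The parametrization, with values in the vector space. -/
def map (z : R2) : E := f (p.chart.symm z)

/-- The derivative of the parametrization at the base point. -/
def deriv : R2 →L[ℝ] E := fderiv ℝ p.map (p.chart s)

theorem mem_target : p.chart s ∈ p.chart.target := p.chart.map_source p.mem_source

theorem map_base : p.map (p.chart s) = f s := by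
  rw [map, p.chart.left_inv p.mem_source]

theorem hasFDerivAt : HasFDerivAt p.map p.deriv (p.chart s) :=
  ((p.contDiffAt _ p.mem_target).differentiableAt (by simp)).hasFDerivAt

theorem deriv_pos {ξ : R2} (hξ : ξ ≠ 0) : 0 < Q (p.deriv ξ) := p.pos _ p.mem_target ξ hξ

theorem deriv_injective : Function.Injective p.deriv := by
  rw [injective_iff_map_eq_zero]
  intro ξ h
  by_contra hne
  have := p.deriv_pos hne
  rw [h, QuadraticMap.map_zero] at this
  exact lt_irrefl _ this

theorem hasFDerivAt_scal [FiniteDimensional ℝ E] (y : E) :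
    HasFDerivAt (fun z => scal Q y (p.map z)) ((scalL Q y).comp p.deriv) (p.chart s) :=
  (scalL Q y).hasFDerivAt.comp _ p.hasFDerivAt

/-- Obtained by differentiating `⟨f, f⟩ = -1`. -/
theorem scal_deriv_base [FiniteDimensional ℝ E] (ξ : R2) : scal Q (f s) (p.deriv ξ) = 0 := by
  have h1 : HasFDerivAt (fun z => scalL Q (p.map z) (p.map z)) _ (p.chart s) :=
    ((scalL Q).hasFDerivAt.comp _ p.hasFDerivAt).clm_apply p.hasFDerivAt
  have h2 : (fun z => scalL Q (p.map z) (p.map z)) = fun _ => (-1 : ℝ) := by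
    funext z
    rw [scalL_apply, scal_self]
    exact (f (p.chart.symm z)).2
  rw [h2] at h1
  have h3 := congrArg (fun T => T ξ) (h1.unique (hasFDerivAt_const _ _))
  simp only [Function.comp_apply, add_apply, ContinuousLinearMap.comp_apply,
    ContinuousLinearMap.flip_apply, p.map_base, scalL_apply, zero_apply] at h3
  rw [scal_comm Q (p.deriv ξ)] at h3
  linarith

/-- The pointed hyperbolic plane tangent to the surface. -/
def tangentPlane [FiniteDimensional ℝ E] : PointedPlane Q where
  q := f s
  U := LinearMap.range (p.deriv : R2 →ₗ[ℝ] E)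
  q_mem := (f s).2
  finrank_U := by
    rw [LinearMap.finrank_range_of_inj p.deriv_injective]
    simp
  posDef_U := by
    rintro ⟨_, ξ, rfl⟩ hne
    refine p.deriv_pos ?_
    rintro rfl
    exact hne (Subtype.ext (map_zero p.deriv))
  ortho := by
    rintro _ ⟨ξ, rfl⟩
    exact p.scal_deriv_base ξ

theorem mem_tangentPlane_W [FiniteDimensional ℝ E] {y : E} (h : ∀ ξ, scal Q y (p.deriv ξ) = 0) :
    y ∈ p.tangentPlane.W := by
  rw [PointedPlane.mem_W]
  rintro _ ⟨ξ, rfl⟩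
  rw [scal_comm]
  exact h ξ

/-- The tangent plane is orthogonal to `y` at the local extrema of `⟨y, ·⟩` on the surface. -/
theorem scal_deriv_eq_zero_of_isLocalExtr [FiniteDimensional ℝ E] {y : E}
    (h : IsLocalExtr (fun t => scal Q y (f t)) s)
    (ξ : R2) : scal Q y (p.deriv ξ) = 0 := by
  have hc : Filter.Tendsto p.chart.symm (𝓝 (p.chart s)) (𝓝 s) := by
    have := p.chart.continuousAt_symm p.mem_target
    rwa [ContinuousAt, p.chart.left_inv p.mem_source] at this
  have h1 : IsLocalExtr (fun z => scal Q y (p.map z)) (p.chart s) := by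
    rcases h with h | h
    · refine Or.inl ?_
      filter_upwards [hc.eventually h] with z hz
      rw [p.map_base]
      exact hz
    · refine Or.inr ?_
      filter_upwards [hc.eventually h] with z hz
      rw [p.map_base]
      exact hz
  exact congrArg (fun T => T ξ) (h1.hasFDerivAt_eq_zero (p.hasFDerivAt_scal y))

end LocalParam

/-! ### Acausality -/

theorem map_smul_add_smul_neg {x y : E} (hx : Q x = -1) (hy : Q y = -1)
    (h1 : -1 < scal Q x y) (h2 : scal Q x y < 1) (a b : ℝ) (hab : a ≠ 0 ∨ b ≠ 0) :
    Q (a • x + b • y) < 0 := by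
  rw [map_smul_add_smul, hx, hy]
  generalize scal Q x y = c at *
  -- Diagonalization in the basis `x + y`, `x - y`, which is orthogonal because `Q x = Q y`.
  have he : a ^ 2 * -1 + 2 * (a * b) * c + b ^ 2 * -1 =
    -((1 + c) / 2 * (a - b) ^ 2 + (1 - c) / 2 * (a + b) ^ 2) := by ring
  rw [he, neg_lt_zero]
  have h1' : 0 < (1 + c) / 2 := by linarith
  have h2' : 0 < (1 - c) / 2 := by linarith
  rcases eq_or_ne a b with rfl | hne
  · have : a + a ≠ 0 := by
      intro h
      have : a = 0 := by linarith
      simp [this] at hab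
    positivity
  · have := sub_ne_zero.2 hne
    positivity

/-- Two points spanning a negative definite plane lie in the fiber over the base point of a
warped projection. -/
theorem PointedPlane.exists_projU_eq_zero [FiniteDimensional ℝ E] (P : PointedPlane Q) {x y : E}
    (hx : Q x = -1)
    (hy : Q y = -1) (h1 : -1 < scal Q x y) (h2 : scal Q x y < 1) :
    ∃ P' : PointedPlane Q, P'.projU x = 0 ∧ P'.projU y = 0 := by
  set c := scal Q x y with hc
  have hd : 0 < 1 - c ^ 2 := by nlinarith
  -- The coefficients come from inverting the Gram matrix of `x, y`, of determinant `1 - c ^ 2`.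
  -- With them `T` is the orthogonal projection onto the complement of `span {x, y}`, and the new
  -- plane is the image of `P.U`.
  let α : E →ₗ[ℝ] ℝ := (1 - c ^ 2)⁻¹ • (scal Q x + c • scal Q y)
  let β : E →ₗ[ℝ] ℝ := (1 - c ^ 2)⁻¹ • (scal Q y + c • scal Q x)
  let T : E →ₗ[ℝ] E := LinearMap.id + (α.smulRight x + β.smulRight y)
  have hα (u : E) : α u = (1 - c ^ 2)⁻¹ * (scal Q x u + c * scal Q y u) := rfl
  have hβ (u : E) : β u = (1 - c ^ 2)⁻¹ * (scal Q y u + c * scal Q x u) := rfl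
  have hT (u : E) : T u = u + (α u • x + β u • y) := rfl
  have hyx : scal Q y x = c := by rw [scal_comm]
  have hTx (u : E) : scal Q x (T u) = 0 := by
    rw [hT, map_add, map_add, map_smul, map_smul, scal_self, hx, ← hc, hα, hβ]
    simp only [smul_eq_mul]
    field_simp
    ring
  have hTy (u : E) : scal Q y (T u) = 0 := by
    rw [hT, map_add, map_add, map_smul, map_smul, scal_self, hy, hyx, hα, hβ]
    simp only [smul_eq_mul]
    field_simp
    ring
  -- The component removed by `T` lies in a negative definite plane, so `T` can only increase `Q`
  -- and the image of `P.U` stays positive definite.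
  have hQT (u : E) : Q u ≤ Q (T u) := by
    have h3 : u = T u - (α u • x + β u • y) := by rw [hT]; abel
    have h4 : scal Q (T u) (α u • x + β u • y) = 0 := by
      rw [map_add, map_smul, map_smul, scal_comm, hTx, scal_comm, hTy]; simp
    conv_lhs => rw [h3, map_sub_eq, h4]
    have h5 : Q (α u • x + β u • y) ≤ 0 := by
      by_cases hab : α u ≠ 0 ∨ β u ≠ 0
      · exact (map_smul_add_smul_neg hx hy h1 h2 _ _ hab).le
      · push Not at hab
        rw [hab.1, hab.2]; simp
    linarith
  have hpos {u : E} (hu : u ∈ P.U) (h : u ≠ 0) : 0 < Q (T u) :=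
    (P.pos_of_mem_U hu h).trans_le (hQT u)
  have hinj : Function.Injective (T.domRestrict P.U) := by
    rw [injective_iff_map_eq_zero]
    rintro ⟨u, hu⟩ h0
    by_contra hne
    have := hpos hu (fun h => hne (Subtype.ext h))
    rw [show T u = 0 from h0, QuadraticMap.map_zero] at this
    exact lt_irrefl _ this
  let P' : PointedPlane Q :=
    { q := x
      U := LinearMap.range (T.domRestrict P.U)
      q_mem := hx
      finrank_U := by rw [LinearMap.finrank_range_of_inj hinj, P.finrank_U]
      posDef_U := by
        rintro ⟨_, ⟨u, hu⟩, rfl⟩ hne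
        refine hpos hu ?_
        rintro rfl
        exact hne (Subtype.ext (map_zero T))
      ortho := by
        rintro _ ⟨⟨u, hu⟩, rfl⟩
        exact hTx u }
  refine ⟨P', P'.projU_eq_zero_iff.2 ?_, P'.projU_eq_zero_iff.2 ?_⟩
  · rw [P'.mem_W]
    rintro _ ⟨⟨u, hu⟩, rfl⟩
    rw [scal_comm]
    exact hTx u
  · rw [P'.mem_W]
    rintro _ ⟨⟨u, hu⟩, rfl⟩
    rw [scal_comm]
    exact hTy u

/-- Two points of the pseudo-hyperbolic space with `|⟨x, y⟩| > 1` form an acausal pair. -/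
theorem isAcausalPair_of_one_lt_sq [FiniteDimensional ℝ E] {x y : PseudoHyp Q}
    (h : 1 < scal Q (x : E) y ^ 2) :
    IsAcausalPair Q x y := by
  have hx : Q (x : E) = -1 := x.2
  have hy : Q (y : E) = -1 := y.2
  have hxs : (x : E) ∈ Submodule.span ℝ {(x : E), (y : E)} := Submodule.subset_span (by simp)
  have hys : (y : E) ∈ Submodule.span ℝ {(x : E), (y : E)} := Submodule.subset_span (by simp)
  -- The positive direction is `y + ⟨x, y⟩ x`, which is orthogonal to `x` and has square `⟨x, y⟩ ^ 2
  -- - 1`; the negative one is `x`.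
  refine hasSignature_of_forall (N := ℝ) (N' := ℝ) ?_
    (LinearMap.toSpanSingleton ℝ E ((y : E) + scal Q (x : E) y • x)) ?_ (by simp) ?_
    (LinearMap.toSpanSingleton ℝ E (x : E)) ?_ (by simp) ?_
  · classical
    have := finrank_span_finset_le_card (R := ℝ) (M := E) {(x : E), (y : E)}
    simp only [Finset.coe_insert, Finset.coe_singleton] at this
    exact this.trans Finset.card_le_two
  · intro r
    rw [LinearMap.toSpanSingleton_apply]
    exact Submodule.smul_mem _ _ (add_mem hys (Submodule.smul_mem _ _ hxs))
  · intro r hr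
    rw [LinearMap.toSpanSingleton_apply, map_smul_eq, map_add_eq, map_smul_eq, map_smul, hx, hy,
      scal_comm Q (y : E), smul_eq_mul]
    have : 0 < r ^ 2 := by positivity
    exact mul_pos this (by nlinarith)
  · intro r
    rw [LinearMap.toSpanSingleton_apply]
    exact Submodule.smul_mem _ _ hxs
  · intro r hr
    rw [LinearMap.toSpanSingleton_apply, map_smul_eq, hx]
    have : 0 < r ^ 2 := by positivity
    linarith

/-- All the projections of the surface onto positive definite planes are injective. -/
def ProjInjective [FiniteDimensional ℝ E] (Q : QuadraticForm ℝ E) (f : S → PseudoHyp Q) : Prop :=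
  ∀ P : PointedPlane Q, Function.Injective fun s => P.projU (f s : E)

theorem IsEntireGraph.projInjective [FiniteDimensional ℝ E] (h : IsEntireGraph Q f) :
    ProjInjective Q f := by
  intro P s t hst
  obtain ⟨-, -, ψ, -, hψ, -⟩ := h P
  rw [← hψ s, ← hψ t]
  exact congrArg ψ (P.warpedProj_eq_iff.2 hst)

/-- If `f t` were orthogonal to the tangent plane at `s`, both `f s` and `f t` would project to zero
on that plane. -/
theorem ProjInjective.exists_scal_deriv_ne_zero [FiniteDimensional ℝ E] (hi : ProjInjective Q f)
    {s t : S}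
    (p : LocalParam Q f s) (hst : s ≠ t) : ∃ ξ, scal Q (f t) (p.deriv ξ) ≠ 0 := by
  by_contra! h
  refine hst (hi p.tangentPlane ?_)
  change p.tangentPlane.projU _ = p.tangentPlane.projU _
  rw [p.tangentPlane.projU_eq_zero_iff.2 (p.mem_tangentPlane_W p.scal_deriv_base),
    p.tangentPlane.projU_eq_zero_iff.2 (p.mem_tangentPlane_W h)]

/-- The function `⟨f t, f ·⟩` never takes a value in the open interval `(-1, 1)`. By continuity, the
value `1` would then be a local minimum and the value `-1` a local maximum, and a critical point `s
≠ t` is excluded by the previous lemma. -/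
theorem ProjInjective.one_lt_scal_sq [FiniteDimensional ℝ E] [IsManifold (𝓡 2) ∞ S]
    (hi : ProjInjective Q f)
    (hf : IsSpacelikeImmersion Q f) {s t : S} (hst : s ≠ t) :
    1 < scal Q (f s : E) (f t) ^ 2 := by
  have key : ∀ s' : S, -1 < scal Q (f t : E) (f s') → scal Q (f t : E) (f s') < 1 → False := by
    intro s' h1 h2
    obtain ⟨p⟩ := hf.exists_localParam t
    obtain ⟨P', h3, h4⟩ := p.tangentPlane.exists_projU_eq_zero (f t).2 (f s').2 h1 h2
    have : t = s' := hi P' (h3.trans h4.symm)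
    rw [← this, scal_self, show Q (f t : E) = -1 from (f t).2] at h1
    exact lt_irrefl _ h1
  by_contra! hle
  rw [scal_comm] at hle
  obtain ⟨h1, h2⟩ := abs_le.1 ((sq_le_one_iff_abs_le_one _).1 hle)
  obtain ⟨p⟩ := hf.exists_localParam s
  obtain ⟨ξ, hξ⟩ := hi.exists_scal_deriv_ne_zero p hst
  have hcont : Continuous fun s' => scal Q (f t : E) (f s') :=
    continuous_scal continuous_const hf.1.continuous
  refine hξ (p.scal_deriv_eq_zero_of_isLocalExtr ?_ ξ)
  rcases h1.lt_or_eq with h1' | h1'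
  · rcases h2.lt_or_eq with h2' | h2'
    · exact (key s h1' h2').elim
    · refine Or.inl ?_
      filter_upwards [hcont.continuousAt.eventually (lt_mem_nhds (h1'))] with z hz
      rw [h2']
      by_contra! hlt
      exact key z hz hlt
  · refine Or.inr ?_
    have hlt1 : scal Q (f t : E) (f s) < 1 := by rw [← h1']; norm_num
    filter_upwards [hcont.continuousAt.eventually (gt_mem_nhds hlt1)] with z hz
    rw [← h1']
    by_contra! hlt
    exact key z hlt hz

theorem ProjInjective.isAcausalSet [FiniteDimensional ℝ E] [IsManifold (𝓡 2) ∞ S]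
    (hi : ProjInjective Q f)
    (hf : IsSpacelikeImmersion Q f) : IsAcausalSet Q (Set.range f) := by
  rintro _ ⟨s, rfl⟩ _ ⟨t, rfl⟩ hst
  exact isAcausalPair_of_one_lt_sq (hi.one_lt_scal_sq hf fun h => hst (congrArg f h))

/-- Scalar products of points of a connected entire graph are at most `-1`. -/
theorem ProjInjective.scal_le [FiniteDimensional ℝ E] [IsManifold (𝓡 2) ∞ S] [ConnectedSpace S]
    (hi : ProjInjective Q f)
    (hf : IsSpacelikeImmersion Q f) (s t : S) : scal Q (f s : E) (f t) ≤ -1 := by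
  by_contra! h
  have hcont : Continuous fun s' => scal Q (f s' : E) (f t) :=
    continuous_scal hf.1.continuous continuous_const
  have ht : scal Q (f t : E) (f t) = -1 := by
    rw [scal_self, show Q (f t : E) = -1 from (f t).2]
  have hsq (s' : S) : 1 ≤ scal Q (f s' : E) (f t) ^ 2 := by
    by_cases hs : s' = t
    · rw [hs, ht]; norm_num
    · exact (hi.one_lt_scal_sq hf hs).le
  -- A value above `-1` would be nonnegative because its square is at least `1`. Since the value at
  -- `t` is `-1`, connectedness would then produce the forbidden value `0`.
  have h0 : (0 : ℝ) ∈ Set.range fun s' => scal Q (f s' : E) (f t) := by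
    have h1 : 0 ≤ scal Q (f s : E) (f t) := by nlinarith [hsq s]
    exact mem_range_of_exists_le_of_exists_ge hcont ⟨t, by simp only [ht]; norm_num⟩ ⟨s, h1⟩
  obtain ⟨s', hs'⟩ := h0
  have := hsq s'
  simp only at hs'
  rw [hs'] at this
  norm_num at this

theorem IsEntireGraph.existsUnique_mem [FiniteDimensional ℝ E] (h : IsEntireGraph Q f)
    {A : Set (PseudoHyp Q)}
    (hA : IsTimelikeSphere Q A) : ∃! s : S, f s ∈ A := by
  obtain ⟨P, rfl⟩ := hA
  obtain ⟨-, -, ψ, -, hψ, hφ⟩ := h P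
  refine ⟨ψ P.q, hφ P.q P.q_mem_plane, fun s hs => ?_⟩
  rw [← hψ s]
  exact congrArg ψ hs

end PseudoHyperbolic
end

noncomputable section

namespace PseudoHyperbolic

/-! ### Local homeomorphisms onto a vector space along which segments lift -/

section Lifting

open Set Filter

variable {X V : Type*} [TopologicalSpace X] [NormedAddCommGroup V] [NormedSpace ℝ V]
  {φ : X → V}

/-- `g` lifts the segment `t ↦ φ x + t v` on the set `A` of parameters. -/
structure IsLiftOn (φ : X → V) (x : X) (v : V) (A : Set ℝ) (g : ℝ → X) : Prop where
  continuousOn : ContinuousOn g A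
  zero : g 0 = x
  lift : ∀ t ∈ A, φ (g t) = φ x + t • v

theorem IsLiftOn.mono {x : X} {v : V} {A B : Set ℝ} {g : ℝ → X} (h : IsLiftOn φ x v A g)
    (hBA : B ⊆ A) : IsLiftOn φ x v B g :=
  ⟨h.continuousOn.mono hBA, h.zero, fun t ht => h.lift t (hBA ht)⟩

theorem IsLiftOn.eqOn [T2Space X] (hφ : IsLocalHomeomorph φ) {x : X} {v : V} {T : ℝ} (hT : 0 ≤ T)
    {g g' : ℝ → X} (h : IsLiftOn φ x v (Icc 0 T) g) (h' : IsLiftOn φ x v (Icc 0 T) g') :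
    EqOn g g' (Icc 0 T) :=
  (T2Space.isSeparatedMap φ).eqOn_of_comp_eqOn hφ.isLocallyInjective isPreconnected_Icc
    h.continuousOn h'.continuousOn (fun t ht => (h.lift t ht).trans (h'.lift t ht).symm)
    (left_mem_Icc.2 hT) (h.zero.trans h'.zero.symm)

/-- The lift is continued by the local inverse `e.symm` applied to the segment; the two pieces agree
at `t₁`. -/
theorem IsLiftOn.exists_extend {x : X} {v : V} {t₁ t₂ : ℝ} (h0 : 0 ≤ t₁) (h12 : t₁ ≤ t₂)
    {g : ℝ → X} (h : IsLiftOn φ x v (Icc 0 t₁) g) (e : OpenPartialHomeomorph X V)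
    (he : EqOn φ e e.source) (hg : g t₁ ∈ e.source)
    (hγ : ∀ t ∈ Icc t₁ t₂, φ x + t • v ∈ e.target) :
    ∃ g', IsLiftOn φ x v (Icc 0 t₂) g' := by
  classical
  have ht1 : e.symm (φ x + t₁ • v) = g t₁ := by
    rw [← h.lift t₁ ⟨h0, le_rfl⟩, he hg, e.left_inv hg]
  have hc : ContinuousOn (fun t : ℝ => e.symm (φ x + t • v)) (Icc t₁ t₂) :=
    e.continuousOn_symm.comp (by fun_prop) hγ
  refine ⟨fun t => if t ≤ t₁ then g t else e.symm (φ x + t • v), ?_, ?_, fun t ht => ?_⟩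
  · have hu : Icc 0 t₂ = Icc 0 t₁ ∪ Icc t₁ t₂ := (Icc_union_Icc_eq_Icc h0 h12).symm
    rw [hu]
    refine ContinuousOn.union_of_isClosed (h.continuousOn.congr fun t ht => if_pos ht.2)
      (hc.congr fun t ht => ?_) isClosed_Icc isClosed_Icc
    rcases ht.1.eq_or_lt with rfl | hlt
    · simp only [le_refl, if_true]
      exact ht1.symm
    · exact if_neg (not_le.2 hlt)
  · simp only [h0, if_true]
    exact h.zero
  · by_cases htt : t ≤ t₁
    · simp only [htt, if_true]
      exact h.lift t ⟨ht.1, htt⟩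
    · simp only [htt, if_false]
      have hm := hγ t ⟨(not_le.1 htt).le, ht.2⟩
      rw [he (e.map_target hm), e.right_inv hm]

/-- A path of the form `t ↦ φ x + t v` lifts on `[0, 1]` provided its partial lifts do not
escape to infinity. -/
theorem exists_isLiftOn [T2Space X] (hφ : IsLocalHomeomorph φ) (x : X) (v : V)
    (h : ∀ T, 0 < T → T ≤ 1 → ∀ g, IsLiftOn φ x v (Ico 0 T) g → ∃ y, MapClusterPt y (𝓝[<] T) g) :
    ∃ g, IsLiftOn φ x v (Icc 0 1) g := by
  have hγc : Continuous fun t : ℝ => φ x + t • v := by fun_prop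
  let A : Set ℝ := {T | T ∈ Icc (0 : ℝ) 1 ∧ ∃ g, IsLiftOn φ x v (Icc 0 T) g}
  have h0A : (0 : ℝ) ∈ A := by
    refine ⟨by simp, fun _ => x, continuousOn_const, rfl, fun t ht => ?_⟩
    have : t = 0 := le_antisymm ht.2 ht.1
    simp [this]
  have hbdd : BddAbove A := ⟨1, fun T hT => hT.1.2⟩
  set T := sSup A with hTdef
  have hT0 : 0 ≤ T := le_csSup hbdd h0A
  have hT1 : T ≤ 1 := csSup_le ⟨0, h0A⟩ fun t ht => ht.1.2
  have hlt {t : ℝ} (ht0 : 0 ≤ t) (ht : t < T) : ∃ t' ∈ A, t < t' ∧ t' ≤ T := by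
    obtain ⟨t', ht', htt'⟩ := exists_lt_of_lt_csSup ⟨0, h0A⟩ ht
    exact ⟨t', ht', htt', le_csSup hbdd ht'⟩
  have hdown {t : ℝ} (ht0 : 0 ≤ t) (ht : t < T) : ∃ g, IsLiftOn φ x v (Icc 0 t) g := by
    obtain ⟨t', ⟨-, g, hg⟩, htt', -⟩ := hlt ht0 ht
    exact ⟨g, hg.mono (Icc_subset_Icc le_rfl htt'.le)⟩
  -- A lift extended beyond the supremum `T` must already reach time `1`. It remains to find a local
  -- inverse defined around the point of the segment at time `T`, both for `T = 0` and for `T > 0`.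
  have key (t₁ : ℝ) (g : ℝ → X) (ht0 : 0 ≤ t₁) (ht1 : t₁ ≤ T)
      (hg : IsLiftOn φ x v (Icc 0 t₁) g) (e : OpenPartialHomeomorph X V)
      (he : EqOn φ e e.source) (hge : g t₁ ∈ e.source) (δ : ℝ) (hδ : 0 < δ)
      (hγ : ∀ t ∈ Icc t₁ (T + δ), φ x + t • v ∈ e.target) :
      ∃ g, IsLiftOn φ x v (Icc 0 1) g := by
    obtain ⟨g', hg'⟩ := hg.exists_extend ht0 (ht1.trans (by linarith : T ≤ T + δ)) e he hge hγ
    by_cases hle : 1 ≤ T + δ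
    · exact ⟨g', hg'.mono (Icc_subset_Icc le_rfl hle)⟩
    · have : T + δ ∈ A := ⟨⟨by linarith, by linarith⟩, g', hg'⟩
      have := le_csSup hbdd this
      linarith
  rcases hT0.eq_or_lt with hT0' | hT0'
  · obtain ⟨e, hxe, he⟩ := hφ x
    have hmem : φ x + T • v ∈ e.target := by
      rw [← hT0', zero_smul, add_zero, he]
      exact e.map_source hxe
    obtain ⟨δ, hδ, hball⟩ := Metric.mem_nhds_iff.1
      (hγc.continuousAt.preimage_mem_nhds (e.open_target.mem_nhds hmem))
    obtain ⟨g, hg⟩ := h0A.2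
    refine key 0 g le_rfl hT0 hg e (fun y _ => congrFun he y) (hg.zero ▸ hxe) (δ / 2)
      (half_pos hδ) fun t ht => hball ?_
    rw [Metric.mem_ball, Real.dist_eq, abs_lt]
    constructor <;> linarith [ht.1, ht.2]
  -- The lifts on the intervals `[0, t]`, chosen separately for each `t < T`, agree by uniqueness
  -- and glue to a lift on `[0, T)`.
  · let g : ℝ → X := fun t =>
      if ht : 0 ≤ t ∧ t < T then (hdown ht.1 ht.2).choose t else x
    have hgt {t : ℝ} (ht0 : 0 ≤ t) (ht : t < T) {t' : ℝ} (htt' : t ≤ t') {L : ℝ → X}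
        (hL : IsLiftOn φ x v (Icc 0 t') L) : g t = L t := by
      have h1 := (hdown ht0 ht).choose_spec
      have h2 : g t = (hdown ht0 ht).choose t := dif_pos ⟨ht0, ht⟩
      rw [h2]
      exact h1.eqOn hφ ht0 (hL.mono (Icc_subset_Icc le_rfl htt')) ⟨ht0, le_rfl⟩
    have hg : IsLiftOn φ x v (Ico 0 T) g := by
      refine ⟨fun t ht => ?_, ?_, fun t ht => ?_⟩
      · obtain ⟨t', ⟨-, L, hL⟩, htt', ht'T⟩ := hlt ht.1 ht.2
        have h1 : ContinuousWithinAt L (Ico 0 T) t := by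
          refine (hL.continuousOn t ⟨ht.1, htt'.le⟩).mono_of_mem_nhdsWithin ?_
          filter_upwards [self_mem_nhdsWithin, mem_nhdsWithin_of_mem_nhds (gt_mem_nhds htt')]
            with r hr hr' using ⟨hr.1, le_of_lt hr'⟩
        refine h1.congr_of_eventuallyEq ?_ (hgt ht.1 ht.2 htt'.le hL)
        filter_upwards [self_mem_nhdsWithin, mem_nhdsWithin_of_mem_nhds (gt_mem_nhds htt')]
          with r hr hr' using hgt hr.1 hr.2 (le_of_lt hr') hL
      · obtain ⟨L, hL⟩ := hdown le_rfl hT0'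
        rw [hgt le_rfl hT0' le_rfl hL, hL.zero]
      · obtain ⟨L, hL⟩ := hdown ht.1 ht.2
        rw [hgt ht.1 ht.2 le_rfl hL]
        exact hL.lift t ⟨ht.1, le_rfl⟩
    obtain ⟨y, hy⟩ := h T hT0' hT1 g hg
    have hIco : ∀ᶠ t in 𝓝[<] T, t ∈ Ico 0 T := by
      filter_upwards [self_mem_nhdsWithin, mem_nhdsWithin_of_mem_nhds (lt_mem_nhds hT0')]
        with t ht ht' using ⟨le_of_lt ht', ht⟩
    -- The cluster point lies over the end of the segment, so a local inverse around it, entered by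
    -- `g` at some time `t₁` close to `T`, carries the lift past `T`.
    have hφy : φ y = φ x + T • v := by
      have h1 : MapClusterPt (φ y) (𝓝[<] T) (φ ∘ g) :=
        hy.continuousAt_comp hφ.continuous.continuousAt
      have h2 : Tendsto (φ ∘ g) (𝓝[<] T) (𝓝 (φ x + T • v)) := by
        refine Tendsto.congr' ?_ (hγc.continuousAt.tendsto.mono_left nhdsWithin_le_nhds)
        filter_upwards [hIco] with t ht using (hg.lift t ht).symm
      have h3 : (𝓝 (φ y) ⊓ 𝓝 (φ x + T • v)).NeBot := by
        refine NeBot.mono h1 (inf_le_inf le_rfl h2)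
      exact eq_of_nhds_neBot h3
    obtain ⟨e, hye, he⟩ := hφ y
    have hmem : φ x + T • v ∈ e.target := by
      rw [← hφy, he]
      exact e.map_source hye
    obtain ⟨δ, hδ, hball⟩ := Metric.mem_nhds_iff.1
      (hγc.continuousAt.preimage_mem_nhds (e.open_target.mem_nhds hmem))
    have hfreq := hy.frequently (e.open_source.mem_nhds hye)
    have hev : ∀ᶠ t in 𝓝[<] T, T - δ < t :=
      mem_nhdsWithin_of_mem_nhds (lt_mem_nhds (by linarith))
    obtain ⟨t₁, ht₁e, ht₁, ht₁'⟩ := (hfreq.and_eventually (hIco.and hev)).exists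
    obtain ⟨L, hL⟩ := hdown ht₁.1 ht₁.2
    refine key t₁ L ht₁.1 ht₁.2.le hL e (fun y _ => congrFun he y)
      (hgt ht₁.1 ht₁.2 le_rfl hL ▸ ht₁e) (δ / 2) (half_pos hδ) fun t ht => hball ?_
    rw [Metric.mem_ball, Real.dist_eq, abs_lt]
    constructor <;> linarith [ht.1, ht.2]

/-- A local homeomorphism from a connected space to a vector space is bijective as soon as the
partial lifts of segments do not escape to infinity. -/
theorem bijective_of_lifts [T2Space X] [ConnectedSpace X] (hφ : IsLocalHomeomorph φ)
    (h : ∀ (x : X) (v : V) (T : ℝ), 0 < T → T ≤ 1 → ∀ g, IsLiftOn φ x v (Ico 0 T) g →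
      ∃ y, MapClusterPt y (𝓝[<] T) g) :
    Function.Bijective φ := by
  obtain ⟨x⟩ : Nonempty X := inferInstance
  -- Lifts of the segments from `φ x` to all points `v` depend continuously on `v`, so their
  -- endpoints form a continuous section `σ` of `φ`.
  choose g hg using fun v : V => exists_isLiftOn hφ x (v - φ x) (h x (v - φ x))
  let F : C(unitInterval × V, V) := ⟨fun p => φ x + (p.1 : ℝ) • (p.2 - φ x), by fun_prop⟩
  let G : unitInterval × V → X := fun p => g p.2 p.1
  have hG : Continuous G := by
    refine hφ.continuous_lift (T2Space.isSeparatedMap φ) F ?_ ?_ ?_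
    · funext p
      exact (hg p.2).lift p.1 p.1.2
    · have : (fun v => G (0, v)) = fun _ => x := funext fun v => (hg v).zero
      rw [this]
      exact continuous_const
    · intro v
      exact (hg v).continuousOn.comp_continuous continuous_subtype_val fun t => t.2
  let σ : V → X := fun v => G (1, v)
  have hσ : Continuous σ := hG.comp (by fun_prop)
  have hφσ : ∀ v, φ (σ v) = v := by
    intro v
    have := (hg v).lift 1 (by simp)
    rw [one_smul, add_sub_cancel] at this
    exact this
  -- A continuous section of a local homeomorphism is one itself, hence has open range. The range is
  -- also the equalizer of `σ ∘ φ` and the identity, hence closed. By connectedness it is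
  -- everything.
  have hopen : IsOpen (range σ) := by
    refine (IsLocalHomeomorph.of_comp (g := φ) (f := σ) ?_ hφ hσ).isOpenMap.isOpen_range
    rw [show φ ∘ σ = id from funext hφσ]
    exact (Homeomorph.refl V).isLocalHomeomorph
  have hclosed : IsClosed (range σ) := by
    have : range σ = {y | σ (φ y) = y} := by
      ext y
      constructor
      · rintro ⟨v, rfl⟩
        exact congrArg σ (hφσ v)
      · intro hy
        exact ⟨φ y, hy⟩
    rw [this]
    exact isClosed_eq (hσ.comp hφ.continuous) continuous_id
  have huniv : range σ = univ :=
    IsClopen.eq_univ ⟨hclosed, hopen⟩ (range_nonempty σ)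
  refine ⟨?_, fun v => ⟨σ v, hφσ v⟩⟩
  intro y z hyz
  obtain ⟨v, rfl⟩ : y ∈ range σ := huniv ▸ mem_univ y
  obtain ⟨w, rfl⟩ : z ∈ range σ := huniv ▸ mem_univ z
  rw [hφσ, hφσ] at hyz
  rw [hyz]

end Lifting

end PseudoHyperbolic
end

noncomputable section

namespace PseudoHyperbolic

variable {E : Type*} [NormedAddCommGroup E] [NormedSpace ℝ E]
  {S : Type*} [TopologicalSpace S] [ChartedSpace (EuclideanSpace ℝ (Fin 2)) S]
  {Q : QuadraticForm ℝ E} {f : S → PseudoHyp Q}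

/-! ### Charts given by a projection -/

/-- A linear map to the plane which does not decrease the square norm of spacelike vectors
restricts to a local diffeomorphism on spacelike surfaces. -/
theorem IsSpacelikeImmersion.exists_graphParam [IsManifold (𝓡 2) ∞ S]
    (hf : IsSpacelikeImmersion Q f) {A : E →L[ℝ] R2} (hA : ∀ x, Q x ≤ ‖A x‖ ^ 2) (s : S) :
    ∃ p : LocalParam Q f s, ∀ t ∈ p.chart.source, p.chart t = A (f t) := by
  obtain ⟨p⟩ := hf.exists_localParam s
  let g : R2 → R2 := fun z => A (p.map z)
  have hg (y : R2) (hy : y ∈ p.chart.target) : ContDiffAt ℝ ∞ g y :=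
    A.contDiff.contDiffAt.comp y (p.contDiffAt y hy)
  -- A tangent vector killed by `A` would satisfy `Q ≤ 0`, which is impossible on a spacelike
  -- surface; in equal dimensions injectivity gives an isomorphism.
  have hD (y : R2) (hy : y ∈ p.chart.target) :
      ∃ T : R2 ≃L[ℝ] R2, HasFDerivAt g (T : R2 →L[ℝ] R2) y := by
    have h1 : HasFDerivAt g (A.comp (fderiv ℝ p.map y)) y :=
      A.hasFDerivAt.comp y ((p.contDiffAt y hy).differentiableAt (by simp)).hasFDerivAt
    have hinj : Function.Injective (A.comp (fderiv ℝ p.map y) : R2 →ₗ[ℝ] R2) := by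
      rw [injective_iff_map_eq_zero]
      intro ξ hξ
      by_contra hne
      have h2 := (p.pos y hy ξ hne).trans_le (hA _)
      have h3 : A (fderiv ℝ (fun z => (f (p.chart.symm z) : E)) y ξ) = 0 := hξ
      rw [h3] at h2
      simp at h2
    refine ⟨(LinearEquiv.ofInjectiveEndo _ hinj).toContinuousLinearEquiv, ?_⟩
    convert h1 using 1
    ext1 ξ
    rfl
  obtain ⟨T, hT⟩ := hD _ p.mem_target
  -- The inverse function theorem allows composing the chart with `g`, so that the new chart is `A ∘
  -- f` itself.
  let h := (hg _ p.mem_target).toOpenPartialHomeomorph g hT (by simp)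
  have hh (z : R2) : h z = g z := rfl
  let e := p.chart.trans h
  have hsymm (y : R2) (hy : y ∈ e.target) : ContDiffAt ℝ ∞ h.symm y := by
    rw [OpenPartialHomeomorph.trans_target] at hy
    obtain ⟨T', hT'⟩ := hD _ hy.2
    exact h.contDiffAt_symm hy.1 hT' (hg _ hy.2)
  have hmap (y : R2) (hy : y ∈ e.target) : ContDiffAt ℝ ∞ (fun z => (f (e.symm z) : E)) y := by
    have hy' := hy
    rw [OpenPartialHomeomorph.trans_target] at hy'
    exact (p.contDiffAt _ hy'.2).comp y (hsymm y hy)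
  refine ⟨⟨e, ?_, ?_, hmap, ?_⟩, ?_⟩
  · rw [OpenPartialHomeomorph.trans_source]
    exact ⟨p.mem_source, (hg _ p.mem_target).mem_toOpenPartialHomeomorph_source hT (by simp)⟩
  · intro y hy
    have hy' := hy
    rw [OpenPartialHomeomorph.trans_target] at hy'
    have h1 := (p.contMDiffOn_symm _ hy'.2).contMDiffAt (p.chart.open_target.mem_nhds hy'.2)
    exact (h1.comp y (hsymm y hy).contMDiffAt).contMDiffWithinAt
  · intro y hy ξ hξ
    have hy' := hy
    rw [OpenPartialHomeomorph.trans_target] at hy'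
    obtain ⟨T', hT'⟩ := hD _ hy'.2
    have h1 : HasFDerivAt h.symm (T'.symm : R2 →L[ℝ] R2) y := h.hasFDerivAt_symm hy'.1 hT'
    have h2 : HasFDerivAt (fun z => (f (e.symm z) : E))
        ((fderiv ℝ p.map (h.symm y)).comp (T'.symm : R2 →L[ℝ] R2)) y :=
      ((p.contDiffAt _ hy'.2).differentiableAt (by simp)).hasFDerivAt.comp y h1
    rw [h2.fderiv]
    refine p.pos _ hy'.2 _ ?_
    change T'.symm ξ ≠ 0
    simpa using hξ
  · intro t ht
    rw [OpenPartialHomeomorph.trans_source] at ht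
    change A (f (p.chart.symm (p.chart t))) = _
    rw [p.chart.left_inv ht.1]

theorem IsSpacelikeImmersion.isLocalHomeomorph [IsManifold (𝓡 2) ∞ S]
    (hf : IsSpacelikeImmersion Q f) {A : E →L[ℝ] R2} (hA : ∀ x, Q x ≤ ‖A x‖ ^ 2) :
    IsLocalHomeomorph fun s => A (f s) := by
  refine IsLocalHomeomorph.mk _ fun s => ?_
  obtain ⟨p, hp⟩ := hf.exists_graphParam hA s
  exact ⟨p.chart, p.mem_source, fun t ht => (hp t ht).symm⟩

/-- Continuous lifts through a projection are smooth. -/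
theorem IsSpacelikeImmersion.contMDiffAt_lift [IsManifold (𝓡 2) ∞ S]
    (hf : IsSpacelikeImmersion Q f) {A : E →L[ℝ] R2} (hA : ∀ x, Q x ≤ ‖A x‖ ^ 2)
    {V : Type*} [NormedAddCommGroup V] [NormedSpace ℝ V]
    {g : V → S} {γ : V → R2} {t : V} (hg : ContinuousAt g t)
    (h : ∀ᶠ r in 𝓝 t, A (f (g r)) = γ r) (hγ : ContDiff ℝ ∞ γ) :
    ContMDiffAt 𝓘(ℝ, V) (𝓡 2) ∞ g t := by
  obtain ⟨p, hp⟩ := hf.exists_graphParam hA (g t)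
  have hev : g =ᶠ[𝓝 t] p.chart.symm ∘ γ := by
    filter_upwards [h, hg.preimage_mem_nhds (p.chart.open_source.mem_nhds p.mem_source)]
      with r hr hr'
    rw [Function.comp_apply, ← hr, ← hp _ hr', p.chart.left_inv hr']
  have ht : γ t ∈ p.chart.target := by
    rw [← h.self_of_nhds, ← hp _ p.mem_source]
    exact p.mem_target
  refine ContMDiffAt.congr_of_eventuallyEq ?_ hev
  exact ((p.contMDiffOn_symm _ ht).contMDiffAt (p.chart.open_target.mem_nhds ht)).comp t
    hγ.contMDiff.contMDiffAt

/-! ### Lengths for the induced metric -/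

section Length

open MeasureTheory Set

/-- The norm of the induced metric. -/
abbrev formENorm (Q : QuadraticForm ℝ E) (f : S → PseudoHyp Q) (s : S) :
    ENorm (TangentSpace (𝓡 2) s) := ⟨fun v => ENNReal.ofReal √(firstForm Q f s v)⟩

theorem firstForm_smul (s : S) (r : ℝ) (v : TangentSpace (𝓡 2) s) :
    firstForm Q f s (r • v) = r ^ 2 * firstForm Q f s v := by
  rw [firstForm, map_smul]
  exact map_smul_eq Q r _

/-- Homogeneity makes lengths insensitive to reversal and reparametrization of paths. -/
theorem formENorm_smulClass (s : S) :
    letI := formENorm Q f s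
    ENormSMulClass ℝ (TangentSpace (𝓡 2) s) := by
  let := formENorm Q f s
  refine ⟨fun r v => ?_⟩
  change ENNReal.ofReal √(firstForm Q f s (r • v)) = ‖r‖ₑ * ENNReal.ofReal √(firstForm Q f s v)
  rw [firstForm_smul, Real.sqrt_mul (sq_nonneg r), Real.sqrt_sq_eq_abs,
    ENNReal.ofReal_mul (abs_nonneg r), Real.enorm_eq_ofReal_abs]

/-- By this chain rule, lengths in the surface are computed from the velocity of `f ∘ γ` in the
vector space. -/
theorem firstForm_mfderiv (hf : IsSpacelikeImmersion Q f) {γ : ℝ → S} {t : ℝ}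
    (hγ : MDifferentiableAt 𝓘(ℝ, ℝ) (𝓡 2) γ t) :
    firstForm Q f (γ t) (mfderiv 𝓘(ℝ, ℝ) (𝓡 2) γ t (1 : ℝ)) =
      Q (deriv (fun r => (f (γ r) : E)) t) := by
  have h1 : MDifferentiableAt (𝓡 2) 𝓘(ℝ, E) (fun t => (f t : E)) (γ t) :=
    (hf.1.contMDiffAt (x := γ t)).mdifferentiableAt (by simp)
  have h2 := mfderiv_comp t h1 hγ
  rw [mfderiv_eq_fderiv] at h2
  have h3 := congrArg (fun T => T (1 : ℝ)) h2
  rw [firstForm]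
  exact congrArg Q h3.symm

theorem inducedEDist_comm (x y : S) : inducedEDist Q f x y = inducedEDist Q f y x := by
  let : ∀ s : S, ENorm (TangentSpace (𝓡 2) s) := formENorm Q f
  have : ∀ s : S, ENormSMulClass ℝ (TangentSpace (𝓡 2) s) := formENorm_smulClass
  exact Manifold.riemannianEDist_comm

theorem inducedEDist_le (hf : IsSpacelikeImmersion Q f) {γ : ℝ → S} {a b C : ℝ} (hab : a ≤ b)
    (hγ : ContMDiffOn 𝓘(ℝ, ℝ) (𝓡 2) 1 γ (Icc a b)) (hC : 0 ≤ C)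
    (h : ∀ t ∈ Ioo a b, Q (deriv (fun r => (f (γ r) : E)) t) ≤ C ^ 2) :
    inducedEDist Q f (γ a) (γ b) ≤ ENNReal.ofReal (C * (b - a)) := by
  let : ∀ s : S, ENorm (TangentSpace (𝓡 2) s) := formENorm Q f
  have : ∀ s : S, ENormSMulClass ℝ (TangentSpace (𝓡 2) s) := formENorm_smulClass
  have h1 : inducedEDist Q f (γ a) (γ b) ≤ Manifold.pathELength (𝓡 2) γ a b :=
    Manifold.riemannianEDist_le_pathELength hγ rfl rfl hab
  refine h1.trans ?_
  rw [Manifold.pathELength_eq_lintegral_mfderiv_Ioo]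
  have h2 : ∀ t ∈ Ioo a b, ENNReal.ofReal
      √(firstForm Q f (γ t) (mfderiv 𝓘(ℝ, ℝ) (𝓡 2) γ t (1 : ℝ))) ≤ ENNReal.ofReal C := by
    intro t ht
    have hd : MDifferentiableAt 𝓘(ℝ, ℝ) (𝓡 2) γ t :=
      ((hγ t ⟨ht.1.le, ht.2.le⟩).contMDiffAt (Icc_mem_nhds ht.1 ht.2)).mdifferentiableAt
        (by simp)
    rw [firstForm_mfderiv hf hd]
    exact ENNReal.ofReal_le_ofReal (Real.sqrt_le_left hC |>.2 (h t ht))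
  refine (setLIntegral_mono measurable_const h2).trans ?_
  rw [setLIntegral_const, Real.volume_Ioo, ENNReal.ofReal_mul hC]

theorem exists_path_of_inducedEDist_lt (hf : IsSpacelikeImmersion Q f) {x y : S} {r : ENNReal}
    (h : inducedEDist Q f x y < r) :
    ∃ γ : ℝ → S, γ 0 = x ∧ γ 1 = y ∧ ContMDiffOn 𝓘(ℝ, ℝ) (𝓡 2) 1 γ (Icc 0 1) ∧
      ∫⁻ t in Ioo 0 1, ENNReal.ofReal √(Q (deriv (fun r => (f (γ r) : E)) t)) < r := by
  let : ∀ s : S, ENorm (TangentSpace (𝓡 2) s) := formENorm Q f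
  have h' : Manifold.riemannianEDist (𝓡 2) x y < r := h
  obtain ⟨γ, h0, h1, hγ, hl⟩ := Manifold.exists_lt_of_riemannianEDist_lt h'
  refine ⟨γ, h0, h1, hγ, ?_⟩
  rw [Manifold.pathELength_eq_lintegral_mfderiv_Ioo] at hl
  convert hl using 1
  refine setLIntegral_congr_fun measurableSet_Ioo fun t ht => ?_
  have hd : MDifferentiableAt 𝓘(ℝ, ℝ) (𝓡 2) γ t :=
    ((hγ t ⟨ht.1.le, ht.2.le⟩).contMDiffAt (Icc_mem_nhds ht.1 ht.2)).mdifferentiableAt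
      (by simp)
  change ENNReal.ofReal √(Q (deriv (fun r => (f (γ r) : E)) t)) =
    ENNReal.ofReal √(firstForm Q f (γ t) (mfderiv 𝓘(ℝ, ℝ) (𝓡 2) γ t (1 : ℝ)))
  rw [firstForm_mfderiv hf hd]

end Length

end PseudoHyperbolic
end

noncomputable section

namespace PseudoHyperbolic

variable {E : Type*} [NormedAddCommGroup E] [NormedSpace ℝ E]
  {S : Type*} [TopologicalSpace S] [ChartedSpace (EuclideanSpace ℝ (Fin 2)) S]
  {Q : QuadraticForm ℝ E} {f : S → PseudoHyp Q}

/-! ### Lifting segments in a complete surface. -/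

section Complete

open MeasureTheory Set Filter

variable [FiniteDimensional ℝ E]

/-- The first fundamental form is locally bounded below in a local parametrization. -/
theorem LocalParam.exists_lower_bound {s : S} (p : LocalParam Q f s) {K : Set R2}
    (hK : IsCompact K) (hKt : K ⊆ p.chart.target) :
    ∃ c : ℝ, 0 < c ∧ ∀ y ∈ K, ∀ ξ : R2, (c * ‖ξ‖) ^ 2 ≤ Q (fderiv ℝ p.map y ξ) := by
  have hcont : ContinuousOn (fun z : R2 × R2 => Q (fderiv ℝ p.map z.1 z.2))
      (K ×ˢ Metric.sphere (0 : R2) 1) := by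
    refine (continuous_form Q).comp_continuousOn ?_
    have h1 : ContinuousOn (fderiv ℝ p.map) K := fun y hy =>
      ((p.contDiffAt y (hKt hy)).continuousAt_fderiv (by simp)).continuousWithinAt
    exact (h1.comp continuousOn_fst fun z hz => hz.1).clm_apply continuousOn_snd
  obtain ⟨c, hc, hle⟩ := (hK.prod (isCompact_sphere (0 : R2) 1)).exists_forall_le' hcont (a := 0)
    (fun z hz => p.pos z.1 (hKt hz.1) z.2 (by
      intro h0
      have := hz.2
      rw [h0] at this
      simp at this))
  refine ⟨√c, Real.sqrt_pos.2 hc, fun y hy ξ => ?_⟩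
  rw [mul_pow, Real.sq_sqrt hc.le]
  rcases eq_or_ne ξ 0 with rfl | hξ
  · simp
  · have hn : ‖ξ‖ ≠ 0 := norm_ne_zero_iff.2 hξ
    have h1 := hle (y, ‖ξ‖⁻¹ • ξ) ⟨hy, by simp [norm_smul, hn]⟩
    simp only [map_smul, map_smul_eq] at h1
    rw [inv_pow, inv_mul_eq_div, le_div_iff₀ (by positivity)] at h1
    exact h1

/-- Convergence for the induced distance implies convergence in the surface. -/
theorem IsSpacelikeImmersion.tendsto_of_tendsto_inducedEDist [T2Space S] [IsManifold (𝓡 2) ∞ S]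
    (hf : IsSpacelikeImmersion Q f) {A : E →L[ℝ] R2} (hA : ∀ x, Q x ≤ ‖A x‖ ^ 2) {ι : Type*}
    {l : Filter ι} {a : ι → S} {x : S} (h : Tendsto (fun i => inducedEDist Q f (a i) x) l (𝓝 0)) :
    Tendsto a l (𝓝 x) := by
  obtain ⟨p, hp⟩ := hf.exists_graphParam hA x
  set e := p.chart with he
  rw [tendsto_def]
  intro N hN
  have hN' : e.symm ⁻¹' N ∩ e.target ∈ 𝓝 (e x) := by
    refine inter_mem ((e.continuousAt_symm p.mem_target).preimage_mem_nhds ?_)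
      (e.open_target.mem_nhds p.mem_target)
    rwa [e.left_inv p.mem_source]
  obtain ⟨ρ, hρ, hball⟩ := Metric.nhds_basis_closedBall.mem_iff.1 hN'
  obtain ⟨c, hc, hle⟩ := p.exists_lower_bound (isCompact_closedBall (e x) ρ)
    fun y hy => (hball hy).2
  let O : Set S := e.source ∩ e ⁻¹' Metric.ball (e x) ρ
  let K : Set S := e.symm '' Metric.closedBall (e x) ρ
  have hOopen : IsOpen O := e.isOpen_inter_preimage Metric.isOpen_ball
  have hKclosed : IsClosed K :=
    ((isCompact_closedBall (e x) ρ).image_of_continuousOn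
      (e.continuousOn_symm.mono fun y hy => (hball hy).2)).isClosed
  have hOK : O ⊆ K := fun z hz =>
    ⟨e z, Metric.ball_subset_closedBall hz.2, e.left_inv hz.1⟩
  have hKsource : K ⊆ e.source := by
    rintro _ ⟨y, hy, rfl⟩
    exact e.map_target (hball hy).2
  have hON : O ⊆ N := fun z hz => by
    obtain ⟨y, hy, rfl⟩ := hOK hz
    exact (hball hy).1
  have hxO : x ∈ O := ⟨p.mem_source, Metric.mem_ball_self hρ⟩
  have hev : ∀ᶠ i in l, inducedEDist Q f (a i) x < ENNReal.ofReal (c * ρ) :=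
    h.eventually (gt_mem_nhds (by simpa using mul_pos hc hρ))
  filter_upwards [hev] with i hi
  refine hON ?_
  obtain ⟨γ, h0, h1, hγ, hlen⟩ := exists_path_of_inducedEDist_lt hf hi
  rw [← h0]
  by_contra hnot
  have hγc : ContinuousOn γ (Icc 0 1) := hγ.continuousOn
  let Z : Set ℝ := Icc 0 1 ∩ γ ⁻¹' Oᶜ
  have hZ : IsCompact Z := isCompact_Icc.of_isClosed_subset
    (hγc.preimage_isClosed_of_isClosed isClosed_Icc hOopen.isClosed_compl) inter_subset_left
  -- `τ` is the last time at which the path is outside `O`. Afterwards it moves in the chart, where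
  -- a length below `c * ρ` gives a displacement below `ρ`; this puts `γ τ` in `O`, a contradiction.
  obtain ⟨τ, ⟨hτ, hτO⟩, hmax⟩ := hZ.exists_isGreatest ⟨0, by simp, hnot⟩
  have hτ1 : τ < 1 := hτ.2.lt_of_ne (by
    rintro rfl
    exact hτO (h1 ▸ hxO))
  have hin : ∀ t ∈ Ioc τ 1, γ t ∈ O := by
    intro t ht
    by_contra hO
    exact absurd (hmax ⟨⟨hτ.1.trans ht.1.le, ht.2⟩, hO⟩) (not_le.2 ht.1)
  -- As a limit of points of `O`, `γ τ` lies in the closed set `K`, hence still in the domain of the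
  -- chart.
  have hτK : γ τ ∈ K := by
    have hmem : τ ∈ closure (Ioc τ 1) := by
      rw [closure_Ioc hτ1.ne]
      exact left_mem_Icc.2 hτ1.le
    have h2 : ContinuousWithinAt γ (Ioc τ 1) τ :=
      (hγc τ hτ).mono fun t ht => ⟨hτ.1.trans ht.1.le, ht.2⟩
    have h3 := h2.mem_closure hmem (t := K) fun t ht => hOK (hin t ht)
    rwa [hKclosed.closure_eq] at h3
  have hτs : γ τ ∈ e.source := hKsource hτK
  have hFγ : ContDiffOn ℝ 1 (fun t => (f (γ t) : E)) (Icc 0 1) := by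
    rw [← contMDiffOn_iff_contDiffOn]
    exact (hf.1.of_le (by simp)).comp_contMDiffOn hγ
  have hφγ : ContDiffOn ℝ 1 (fun t => A (f (γ t))) (Icc τ 1) :=
    A.contDiff.comp_contDiffOn (hFγ.mono (Icc_subset_Icc hτ.1 le_rfl))
  have hbound := enorm_sub_le_lintegral_deriv_of_contDiffOn_Icc hφγ hτ1.le
  rw [← restrict_Ioo_eq_restrict_Icc] at hbound
  have hpt : ∀ t ∈ Ioo τ 1, ‖deriv (fun t => A (f (γ t))) t‖ₑ ≤
      ENNReal.ofReal c⁻¹ * ENNReal.ofReal √(Q (deriv (fun r => (f (γ r) : E)) t)) := by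
    intro t ht
    have ht' : t ∈ Ioo (0 : ℝ) 1 := ⟨hτ.1.trans_lt ht.1, ht.2⟩
    have hd : DifferentiableAt ℝ (fun t => (f (γ t) : E)) t :=
      ((hFγ t ⟨ht'.1.le, ht'.2.le⟩).contDiffAt (Icc_mem_nhds ht'.1 ht'.2)).differentiableAt
        (by simp)
    have hdA : HasDerivAt (fun t => A (f (γ t))) (A (deriv (fun r => (f (γ r) : E)) t)) t :=
      A.hasFDerivAt.comp_hasDerivAt t hd.hasDerivAt
    have htO := hin t ⟨ht.1, ht.2.le⟩
    have heγ : e (γ t) = A (f (γ t)) := hp _ htO.1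
    have hmap : HasFDerivAt p.map (fderiv ℝ p.map (A (f (γ t)))) (A (f (γ t))) := by
      rw [← heγ]
      exact ((p.contDiffAt _ (e.map_source htO.1)).differentiableAt (by simp)).hasFDerivAt
    have hcomp := hmap.comp_hasDerivAt t hdA
    have hev : (fun r => (f (γ r) : E)) =ᶠ[𝓝 t] p.map ∘ fun t => A (f (γ t)) := by
      filter_upwards [Ioo_mem_nhds ht.1 ht.2] with r hr
      have hrO := hin r ⟨hr.1, hr.2.le⟩
      rw [Function.comp_apply, ← hp _ hrO.1, LocalParam.map, ← he, e.left_inv hrO.1]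
    have hQ := hle (e (γ t)) (Metric.ball_subset_closedBall htO.2)
      (A (deriv (fun r => (f (γ r) : E)) t))
    rw [heγ, ← hcomp.deriv, ← hev.deriv_eq] at hQ
    rw [hdA.deriv, ← ofReal_norm, ← ENNReal.ofReal_mul (by positivity)]
    refine ENNReal.ofReal_le_ofReal ?_
    rw [inv_mul_eq_div, le_div_iff₀ hc, mul_comm]
    exact Real.le_sqrt_of_sq_le hQ
  have hlen' : ‖A (f (γ 1)) - A (f (γ τ))‖ₑ < ENNReal.ofReal ρ := by
    refine (hbound.trans (setLIntegral_mono' measurableSet_Ioo hpt)).trans_lt ?_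
    rw [lintegral_const_mul' _ _ ENNReal.ofReal_ne_top]
    have hmono := lintegral_mono_set (μ := volume)
      (f := fun t => ENNReal.ofReal √(Q (deriv (fun r => (f (γ r) : E)) t)))
      (Ioo_subset_Ioo_left (b := (1 : ℝ)) hτ.1)
    have hρ' : ENNReal.ofReal ρ = ENNReal.ofReal c⁻¹ * ENNReal.ofReal (c * ρ) := by
      rw [← ENNReal.ofReal_mul (by positivity), inv_mul_cancel_left₀ hc.ne']
    rw [hρ']
    refine ENNReal.mul_lt_mul_right ?_ ENNReal.ofReal_ne_top (hmono.trans_lt hlen)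
    simpa using hc
  refine hτO ⟨hτs, ?_⟩
  rw [mem_preimage, Metric.mem_ball, hp _ hτs, hp _ p.mem_source, dist_comm, dist_eq_norm, ← h1]
  rwa [← ofReal_norm, ENNReal.ofReal_lt_ofReal_iff hρ] at hlen'

/-- In a complete spacelike surface the partial lifts of segments converge. -/
theorem IsSpacelikeImmersion.exists_mapClusterPt_of_complete [T2Space S] [IsManifold (𝓡 2) ∞ S]
    (hf : IsSpacelikeImmersion Q f) {A : E →L[ℝ] R2} (hA : ∀ x, Q x ≤ ‖A x‖ ^ 2)
    (hcomp : IsCompleteInduced Q f) {x : S} {v : R2} {T : ℝ} (hT : 0 < T) {g : ℝ → S}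
    (hg : IsLiftOn (fun s => A (f s)) x v (Ico 0 T) g) : ∃ y, MapClusterPt y (𝓝[<] T) g := by
  have hsmooth : ∀ t ∈ Ioo 0 T, ContMDiffAt 𝓘(ℝ, ℝ) (𝓡 2) ∞ g t := by
    intro t ht
    refine hf.contMDiffAt_lift hA (γ := fun t => A (f x) + t • v) ?_ ?_ (by fun_prop)
    · exact (hg.continuousOn t ⟨ht.1.le, ht.2⟩).continuousAt (Ico_mem_nhds ht.1 ht.2)
    · filter_upwards [Ioo_mem_nhds ht.1 ht.2] with r hr using hg.lift r ⟨hr.1.le, hr.2⟩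
  -- The image of the lift under `A` has constant velocity `v`, and `Q ≤ ‖A ·‖ ^ 2`, so the induced
  -- speed is at most `‖v‖`.
  have hdist {a b : ℝ} (ha : a ∈ Ioo 0 T) (hb : b ∈ Ioo 0 T) (hab : a ≤ b) :
      inducedEDist Q f (g a) (g b) ≤ ENNReal.ofReal (‖v‖ * (b - a)) := by
    have hsub : Icc a b ⊆ Ioo 0 T := fun t ht => ⟨ha.1.trans_le ht.1, ht.2.trans_lt hb.2⟩
    refine inducedEDist_le hf hab
      (fun t ht => ((hsmooth t (hsub ht)).of_le (by simp)).contMDiffWithinAt) (norm_nonneg v) ?_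
    intro t ht
    have ht' := hsub ⟨ht.1.le, ht.2.le⟩
    have hF : DifferentiableAt ℝ (fun r => (f (g r) : E)) t := by
      have h1 : ContMDiffAt 𝓘(ℝ, ℝ) 𝓘(ℝ, E) ∞ (fun r => (f (g r) : E)) t :=
        (hf.1.contMDiffAt (x := g t)).comp t (hsmooth t ht')
      exact h1.contDiffAt.differentiableAt (by simp)
    have h2 : HasDerivAt (fun r => A (f (g r))) (A (deriv (fun r => (f (g r) : E)) t)) t :=
      A.hasFDerivAt.comp_hasDerivAt t hF.hasDerivAt
    have h3 : HasDerivAt (fun r => A (f (g r))) v t := by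
      have h4 : HasDerivAt (fun r : ℝ => A (f x) + r • v) ((1 : ℝ) • v) t :=
        ((hasDerivAt_id t).smul_const v).const_add _
      rw [one_smul] at h4
      refine h4.congr_of_eventuallyEq ?_
      filter_upwards [Ioo_mem_nhds ht'.1 ht'.2] with r hr using hg.lift r ⟨hr.1.le, hr.2⟩
    rw [h3.unique h2]
    exact hA _
  -- The shift by `2` keeps every term strictly between `0` and `T`, where the lift is smooth.
  let t : ℕ → ℝ := fun k => T - T / (k + 2)
  have htmem (k : ℕ) : t k ∈ Ioo 0 T := by
    have h1 : T / (k + 2) < T := by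
      rw [div_lt_iff₀ (by positivity)]
      have : (0 : ℝ) ≤ k := Nat.cast_nonneg k
      nlinarith
    have h2 : 0 < T / (k + 2) := by positivity
    exact ⟨by simp only [t]; linarith, by simp only [t]; linarith⟩
  have htmono : Monotone t := by
    intro k l hkl
    simp only [t]
    gcongr
  have hdiv : Tendsto (fun k : ℕ => T / ((k : ℝ) + 2)) atTop (𝓝 0) :=
    tendsto_const_nhds.div_atTop
      (tendsto_atTop_add_const_right _ _ tendsto_natCast_atTop_atTop)
  have httend : Tendsto t atTop (𝓝[<] T) := by
    refine tendsto_nhdsWithin_iff.2 ⟨?_, Eventually.of_forall fun k => (htmem k).2⟩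
    simpa using (tendsto_const_nhds (x := T)).sub hdiv
  obtain ⟨y, hy⟩ := hcomp (fun k => g (t k)) (by
    intro ε hε
    have h1 : Tendsto (fun k : ℕ => ENNReal.ofReal (‖v‖ * (T / ((k : ℝ) + 2)))) atTop (𝓝 0) := by
      have := ENNReal.tendsto_ofReal (hdiv.const_mul ‖v‖)
      simpa using this
    obtain ⟨N, hN⟩ := (h1.eventually (gt_mem_nhds hε)).exists
    have hord : ∀ k ≥ N, ∀ l ≥ k, inducedEDist Q f (g (t k)) (g (t l)) < ε := by
      intro k hk l hl
      refine ((hdist (htmem k) (htmem l) (htmono hl)).trans ?_).trans_lt hN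
      refine ENNReal.ofReal_le_ofReal (mul_le_mul_of_nonneg_left ?_ (norm_nonneg v))
      have h2 := (htmem l).2
      have h3 := htmono hk
      simp only [t] at h2 h3 ⊢
      linarith
    refine ⟨N, fun k hk l hl => ?_⟩
    rcases le_total k l with h | h
    · exact hord k hk l h
    · rw [inducedEDist_comm]
      exact hord l hl k h)
  have hconv := hf.tendsto_of_tendsto_inducedEDist hA hy
  exact ⟨y, (hconv.mapClusterPt : MapClusterPt y atTop (g ∘ t)).of_comp httend⟩

end Complete

/-! ### Lifting segments in a properly immersed surface. -/

section Proper

open Set Filter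

/-- Along a lift the first component is bounded by `R`. The equation `Q = -1` then bounds the square
norm of the second by `1 + R ^ 2 ≤ (R + 1) ^ 2`, so the lift stays in the preimage of a compact set.
-/
theorem exists_mapClusterPt_of_proper {S : Type*} [TopologicalSpace S] {f : S → PseudoHyp Q}
    {n : ℕ} [FiniteDimensional ℝ E]
    {L : E ≃L[ℝ] R2 × EuclideanSpace ℝ (Fin (n + 1))}
    (hL : ∀ x, Q x = ‖(L x).1‖ ^ 2 - ‖(L x).2‖ ^ 2) (hprop : IsProperMap f)
    {x : S} {v : R2} {T : ℝ} (hT : 0 < T) {g : ℝ → S}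
    (hg : IsLiftOn (fun s => (L (f s)).1) x v (Ico 0 T) g) :
    ∃ y, MapClusterPt y (𝓝[<] T) g := by
  set R := ‖(L (f x)).1‖ + T * ‖v‖ with hR
  have hR0 : 0 ≤ R := by positivity
  let K : Set E := {y | Q y = -1} ∩ L ⁻¹' Metric.closedBall 0 (R + 1)
  have hK : IsCompact K := by
    refine IsCompact.inter_left ?_ (isClosed_eq (continuous_form Q) continuous_const)
    exact L.toHomeomorph.isCompact_preimage.2 (isCompact_closedBall _ _)
  have hK' : IsCompact ((↑) ⁻¹' K : Set (PseudoHyp Q)) := by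
    have hcl : IsClosed (PseudoHyp Q) := isClosed_eq (continuous_form Q) continuous_const
    exact hcl.isClosedEmbedding_subtypeVal.isCompact_preimage hK
  have hmem : ∀ t ∈ Ico 0 T, g t ∈ f ⁻¹' ((↑) ⁻¹' K) := by
    intro t ht
    have hq : Q (f (g t) : E) = -1 := (f (g t)).2
    refine ⟨hq, ?_⟩
    have h1 : ‖(L (f (g t))).1‖ ≤ R := by
      have h2 : (L (f (g t))).1 = (L (f x)).1 + t • v := hg.lift t ht
      rw [h2]
      refine (norm_add_le _ _).trans ?_
      rw [norm_smul, Real.norm_of_nonneg ht.1]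
      exact add_le_add le_rfl (mul_le_mul_of_nonneg_right ht.2.le (norm_nonneg v))
    have h3 : ‖(L (f (g t))).2‖ ≤ R + 1 := by
      rw [hL] at hq
      refine abs_le_of_sq_le_sq' ?_ (by positivity) |>.2
      nlinarith [norm_nonneg (L (f (g t))).1]
    rw [mem_preimage, mem_closedBall_zero_iff, Prod.norm_def]
    exact max_le (by linarith) h3
  obtain ⟨y, -, hy⟩ := (hprop.isCompact_preimage hK').exists_mapClusterPt (f := 𝓝[<] T) (u := g) (by
    rw [le_principal_iff, mem_map]
    filter_upwards [self_mem_nhdsWithin, mem_nhdsWithin_of_mem_nhds (lt_mem_nhds hT)]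
      with t ht ht' using hmem t ⟨le_of_lt ht', ht⟩)
  exact ⟨y, hy⟩

end Proper

/-! ### From bijectivity of the linear projection to entire graphs. -/

section Graph

/-- The first component of a linear equivalence onto a product. -/
def fstComp {G : Type*} [NormedAddCommGroup G] [NormedSpace ℝ G] (L : E ≃L[ℝ] R2 × G) :
    E →L[ℝ] R2 := (ContinuousLinearMap.fst ℝ R2 G).comp (L : E →L[ℝ] R2 × G)

theorem sqNorm_fst_ge {n : ℕ} {L : E ≃L[ℝ] R2 × EuclideanSpace ℝ (Fin (n + 1))}
    (hL : ∀ x, Q x = ‖(L x).1‖ ^ 2 - ‖(L x).2‖ ^ 2) (x : E) :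
    Q x ≤ ‖fstComp L x‖ ^ 2 := by
  rw [hL]
  change _ ≤ ‖(L x).1‖ ^ 2
  linarith [sq_nonneg ‖(L x).2‖]

variable [FiniteDimensional ℝ E] [IsManifold (𝓡 2) ∞ S]

/-- The inverse `σ` of the linear projection is continuous, hence smooth as a lift of the identity.
Since the warped projection preserves the `U`-component, its inverse on `H` is `x ↦ σ (L x).1`,
which is smooth on all of `E`. -/
theorem IsSpacelikeImmersion.isDiffeoOnto_of_bijective {n : ℕ} (hf : IsSpacelikeImmersion Q f)
    (P : PointedPlane Q) {L : E ≃L[ℝ] R2 × EuclideanSpace ℝ (Fin (n + 1))}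
    (hL : ∀ x, Q x = ‖(L x).1‖ ^ 2 - ‖(L x).2‖ ^ 2)
    (hP : ∀ x, P.projU x = L.symm ((L x).1, 0))
    (hbij : Function.Bijective fun s => (L (f s)).1) :
    IsDiffeoOnto (fun s => P.warpedProj (f s : E)) P.plane := by
  have hA := sqNorm_fst_ge hL
  obtain ⟨σ, hσ1, hσ2⟩ := Function.bijective_iff_has_inverse.1 hbij
  have hσc : Continuous σ := by
    let h := (hf.isLocalHomeomorph hA).toHomeomorphOfBijective hbij
    have : σ = h.symm := by
      funext v
      rw [Homeomorph.eq_symm_apply]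
      exact hσ2 v
    rw [this]
    exact h.symm.continuous
  have hσs : ContMDiff 𝓘(ℝ, R2) (𝓡 2) ∞ σ := fun v =>
    hf.contMDiffAt_lift hA (γ := id) hσc.continuousAt (Filter.Eventually.of_forall hσ2)
      contDiff_id
  have hproj (x : E) : (L (P.projU x)).1 = (L x).1 := by rw [hP]; simp
  have hzero {x : E} : P.projU x = 0 ↔ (L x).1 = 0 := by
    constructor
    · intro h
      rw [← hproj, h]; simp
    · intro h
      rw [hP, h]
      exact map_zero L.symm
  refine ⟨?_, ?_, fun x => σ (L x).1, ?_, ?_, ?_⟩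
  · have hsm : ContDiff ℝ ∞ P.projU := (LinearMap.toContinuousLinearMap P.projU).contDiff
    have : ContDiff ℝ ∞ P.warpedProj := by
      have h1 : P.warpedProj = fun x => P.projU x + √(1 + Q (P.projU x)) • P.q :=
        funext P.warpedProj_eq
      rw [h1]
      refine hsm.add (ContDiff.smul (ContDiff.sqrt (contDiff_const.add
        ((contDiff_form Q).comp hsm)) fun x => ?_) contDiff_const)
      have := P.nonneg_of_mem_U (P.projU_mem x)
      positivity
    exact this.contMDiff.comp hf.1
  · intro s
    exact P.mem_plane_iff.2 ⟨_, P.projU_mem _, P.warpedProj_eq _⟩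
  · refine (hσs.comp ?_).contMDiffOn
    exact (fstComp L).contDiff.contMDiff
  · intro s
    have : (L (P.warpedProj (f s))).1 = (L (f s)).1 := by
      rw [← hproj, P.projU_warpedProj, hproj]
    simp only [this]
    exact hσ1 s
  · intro x hx
    obtain ⟨u, hu, rfl⟩ := P.mem_plane_iff.1 hx
    set x := u + √(1 + Q u) • P.q with hxdef
    have h1 : P.projU x = u := by
      rw [hxdef, map_add, map_smul, P.projU_q, P.projU_of_mem_U hu, smul_zero, add_zero]
    have h2 : P.projU (f (σ (L x).1)) = u := by
      have h3 : (L (f (σ (L x).1))).1 = (L x).1 := hσ2 _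
      rw [hP, h3, ← hP, h1]
    change P.warpedProj (f (σ (L x).1)) = x
    rw [P.warpedProj_eq, h2]

theorem IsSpacelikeImmersion.isEntireGraph {n : ℕ} (hQ : HasSignature Q ⊤ 2 (n + 1))
    [T2Space S] [ConnectedSpace S] (hf : IsSpacelikeImmersion Q f)
    (h : IsProperMap f ∨ IsCompleteInduced Q f) : IsEntireGraph Q f := by
  intro P
  obtain ⟨L, hL, hP⟩ := P.exists_coord hQ
  have hA := sqNorm_fst_ge hL
  refine hf.isDiffeoOnto_of_bijective P hL hP
    (bijective_of_lifts (hf.isLocalHomeomorph hA) fun x v T hT _ g hg => ?_)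
  rcases h with h | h
  · exact exists_mapClusterPt_of_proper hL h hT hg
  · exact hf.exists_mapClusterPt_of_complete hA h hT hg

end Graph

end PseudoHyperbolic
end

noncomputable section

namespace PseudoHyperbolic

variable {E : Type*} [NormedAddCommGroup E] [NormedSpace ℝ E]

/-! ### The space of rays -/

section Ray

theorem continuous_rayOfNeZero :
    Continuous fun v : {v : E // v ≠ 0} => rayOfNeZero ℝ v.1 v.2 := continuous_coinduced_rng

/-- The unit vector of a ray. -/
def rayUnit (r : Module.Ray ℝ E) : E := ‖r.someVector‖⁻¹ • r.someVector

theorem rayUnit_rayOfNeZero {v : E} (hv : v ≠ 0) : rayUnit (rayOfNeZero ℝ v hv) = ‖v‖⁻¹ • v := by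
  have h1 : SameRay ℝ (rayOfNeZero ℝ v hv).someVector v := by
    rw [← ray_eq_iff (Module.Ray.someVector_ne_zero _) hv]
    exact Module.Ray.someVector_ray _
  exact (sameRay_iff_inv_norm_smul_eq_of_ne (Module.Ray.someVector_ne_zero _) hv).1 h1

theorem continuous_rayUnit : Continuous (rayUnit : Module.Ray ℝ E → E) := by
  rw [continuous_coinduced_dom]
  have : rayUnit ∘ (fun v : {v : E // v ≠ 0} => rayOfNeZero ℝ v.1 v.2) =
      fun v : {v : E // v ≠ 0} => ‖v.1‖⁻¹ • v.1 := funext fun v => rayUnit_rayOfNeZero v.2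
  rw [this]
  exact (continuous_subtype_val.norm.inv₀ fun v => norm_ne_zero_iff.2 v.2).smul
    continuous_subtype_val

theorem rayUnit_injective : Function.Injective (rayUnit : Module.Ray ℝ E → E) := by
  intro r r' h
  induction r using Module.Ray.ind with | h v hv => ?_
  induction r' using Module.Ray.ind with | h w hw => ?_
  rw [rayUnit_rayOfNeZero, rayUnit_rayOfNeZero] at h
  rw [ray_eq_iff]
  exact (sameRay_iff_inv_norm_smul_eq_of_ne hv hw).2 h

/-- Used to make compact sets of rays closed and continuous bijections from compact sets onto sets
of rays homeomorphisms. -/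
instance : T2Space (Module.Ray ℝ E) :=
  T2Space.of_injective_continuous rayUnit_injective continuous_rayUnit

theorem exists_pos_smul_of_ray_eq {v w : E} {hv : v ≠ 0} {hw : w ≠ 0}
    (h : rayOfNeZero ℝ v hv = rayOfNeZero ℝ w hw) : ∃ c : ℝ, 0 < c ∧ w = c • v := by
  rw [ray_eq_iff] at h
  obtain ⟨c, hc, hcv⟩ := h.exists_pos_left hv hw
  exact ⟨c, hc, hcv.symm⟩

theorem raySpan_triple {a b c : E} (ha : a ≠ 0) (hb : b ≠ 0) (hc : c ≠ 0) :
    raySpan {rayOfNeZero ℝ a ha, rayOfNeZero ℝ b hb, rayOfNeZero ℝ c hc} =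
      Submodule.span ℝ {a, b, c} := by
  apply le_antisymm
  · refine Submodule.span_le.2 ?_
    rintro v ⟨hv, h | h | h⟩ <;>
    · obtain ⟨r, -, rfl⟩ := exists_pos_smul_of_ray_eq h.symm
      exact Submodule.smul_mem _ _ (Submodule.subset_span (by simp))
  · refine Submodule.span_le.2 ?_
    rintro v (rfl | rfl | rfl)
    · exact Submodule.subset_span ⟨ha, by simp⟩
    · exact Submodule.subset_span ⟨hb, by simp⟩
    · exact Submodule.subset_span ⟨hc, by simp⟩

end Ray

/-! ### Triples of isotropic vectors -/

section Triple

variable {Q : QuadraticForm ℝ E} {a b c : E}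

theorem map_combo_of_isotropic (ha : Q a = 0) (hb : Q b = 0) (hc : Q c = 0) (x y z : ℝ) :
    Q (x • a + y • b + z • c) =
      2 * (x * y * scal Q a b + x * z * scal Q a c + y * z * scal Q b c) := by
  rw [map_add_eq, map_smul_add_smul, map_smul_eq, ha, hb, hc]
  simp only [map_add, map_smul, LinearMap.add_apply, LinearMap.smul_apply, smul_eq_mul]
  ring

/-- A plane in the span of three vectors, which is positive definite if these vectors are isotropic
with negative pairwise products. -/
def triplePlane (Q : QuadraticForm ℝ E) (a b c : E) : (ℝ × ℝ) →ₗ[ℝ] E :=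
  LinearMap.coprod
    (LinearMap.toSpanSingleton ℝ E (scal Q b c • a - scal Q a c • b))
    (LinearMap.toSpanSingleton ℝ E (scal Q a c • b - scal Q a b • c))

theorem triplePlane_apply (x : ℝ × ℝ) : triplePlane Q a b c x =
    (x.1 * scal Q b c) • a + ((x.2 - x.1) * scal Q a c) • b + (-(x.2 * scal Q a b)) • c := by
  simp only [triplePlane, LinearMap.coprod_apply, LinearMap.toSpanSingleton_apply]
  module

theorem triplePlane_mem (x : ℝ × ℝ) : triplePlane Q a b c x ∈ Submodule.span ℝ {a, b, c} := by
  rw [triplePlane_apply]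
  refine add_mem (add_mem ?_ ?_) ?_ <;>
  exact Submodule.smul_mem _ _ (Submodule.subset_span (by simp))

/-- The rescaled vectors `⟨b, c⟩ a`, `⟨a, c⟩ b`, `⟨a, b⟩ c` have all their pairwise products equal
to `m = ⟨a, b⟩ ⟨a, c⟩ ⟨b, c⟩ < 0`. On the plane of their differences, `Q` is `-2 m` times the
definite form `x₁ ^ 2 - x₁ x₂ + x₂ ^ 2`. -/
theorem triplePlane_pos (ha : Q a = 0) (hb : Q b = 0) (hc : Q c = 0) (hab : scal Q a b < 0)
    (hac : scal Q a c < 0) (hbc : scal Q b c < 0) {x : ℝ × ℝ} (hx : x ≠ 0) :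
    0 < Q (triplePlane Q a b c x) := by
  rw [triplePlane_apply, map_combo_of_isotropic ha hb hc]
  generalize scal Q a b = p at *
  generalize scal Q a c = q at *
  generalize scal Q b c = r at *
  have hm : 0 < -(p * q * r) := by
    have := mul_pos_of_neg_of_neg hab hac
    nlinarith
  have hpos : 0 < x.1 ^ 2 - x.1 * x.2 + x.2 ^ 2 := by
    by_cases h : x.2 = 0
    · have h1 : x.1 ≠ 0 := fun h1 => hx (Prod.ext h1 h)
      rw [h]
      simp only [mul_zero, sub_zero]
      positivity
    · have := sq_nonneg (x.1 - x.2 / 2)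
      have h2 : 0 < x.2 ^ 2 := by positivity
      nlinarith
  have he : 2 * (x.1 * r * ((x.2 - x.1) * q) * p + x.1 * r * (-(x.2 * p)) * q +
      (x.2 - x.1) * q * (-(x.2 * p)) * r) =
      2 * (-(p * q * r) * (x.1 ^ 2 - x.1 * x.2 + x.2 ^ 2)) := by ring
  rw [he]
  positivity

variable [FiniteDimensional ℝ E]

/-- Three isotropic vectors with negative pairwise products span a space of signature `(2, 1)`. -/
theorem hasSignature_two_one (ha : Q a = 0) (hb : Q b = 0) (hc : Q c = 0) (hab : scal Q a b < 0)
    (hac : scal Q a c < 0) (hbc : scal Q b c < 0) :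
    HasSignature Q (Submodule.span ℝ {a, b, c}) 2 1 := by
  refine hasSignature_of_forall ?_ (triplePlane Q a b c) triplePlane_mem (by simp)
    (fun x hx => triplePlane_pos ha hb hc hab hac hbc hx)
    (LinearMap.toSpanSingleton ℝ E (a + b)) (fun r => ?_) (by simp) (fun r hr => ?_)
  · classical
    have := finrank_span_finset_le_card (R := ℝ) (M := E) {a, b, c}
    simp only [Finset.coe_insert, Finset.coe_singleton] at this
    exact this.trans Finset.card_le_three
  · rw [LinearMap.toSpanSingleton_apply]
    exact Submodule.smul_mem _ _ (add_mem (Submodule.subset_span (by simp))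
      (Submodule.subset_span (by simp)))
  · rw [LinearMap.toSpanSingleton_apply, map_smul_eq, map_add_eq, ha, hb]
    have : 0 < r ^ 2 := by positivity
    nlinarith

/-- If `⟨a, b⟩ = 0`, then `span {a, b}` is totally isotropic, hence of dimension at most `1` in
signature `(1, 2)`, and adding `c` cannot give dimension `3`. -/
theorem HasSignature.scal_ne_zero {F : Submodule ℝ E} (h : HasSignature Q F 1 2) (ha : Q a = 0)
    (hb : Q b = 0) (hF : F = Submodule.span ℝ {a, b, c}) : scal Q a b ≠ 0 := by
  intro h0
  have hle : Submodule.span ℝ {a, b} ≤ F := by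
    rw [hF]
    exact Submodule.span_mono (by
      rintro x (rfl | rfl) <;> simp)
  have h1 := h.finrank_le_of_nonneg hle (fun x hx => by
    obtain ⟨r, s, rfl⟩ := Submodule.mem_span_pair.1 hx
    rw [map_smul_add_smul, ha, hb, h0]
    simp)
  have h2 : F = Submodule.span ℝ {a, b} ⊔ Submodule.span ℝ {c} := by
    rw [hF, ← Submodule.span_union]
    congr 1
    ext x
    simp only [Set.mem_insert_iff, Set.mem_singleton_iff, Set.mem_union, or_assoc]
  have h3 := Submodule.finrank_add_le_finrank_add_finrank
    (Submodule.span ℝ {a, b}) (Submodule.span ℝ {c})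
  rw [← h2, h.1] at h3
  have h4 : Module.finrank ℝ (Submodule.span ℝ {c}) ≤ 1 := by
    have := finrank_span_finset_le_card (R := ℝ) (M := E) {c}
    simp only [Finset.coe_singleton, Finset.card_singleton] at this
    exact this
  omega

/-- Three isotropic vectors with nonpositive pairwise products do not span a space of
signature `(1, 2)`. -/
theorem not_hasSignature_one_two (ha : Q a = 0) (hb : Q b = 0) (hc : Q c = 0)
    (hab : scal Q a b ≤ 0) (hac : scal Q a c ≤ 0) (hbc : scal Q b c ≤ 0) :
    ¬ HasSignature Q (Submodule.span ℝ {a, b, c}) 1 2 := by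
  intro h
  have h1 : scal Q a b < 0 := hab.lt_of_ne (h.scal_ne_zero (c := c) ha hb rfl)
  have h2 : scal Q a c < 0 := hac.lt_of_ne (h.scal_ne_zero (c := b) ha hc (by
    rw [Set.pair_comm b c]))
  have h3 : scal Q b c < 0 := hbc.lt_of_ne (h.scal_ne_zero (c := a) hb hc (by
    rw [Set.insert_comm a b, Set.pair_comm a c]))
  have h4 : Module.finrank ℝ (ℝ × ℝ) ≤ sigPos (Q.restrict (Submodule.span ℝ {a, b, c})) :=
    le_sigPos_of_forall_pos ((triplePlane Q a b c).codRestrict _ triplePlane_mem)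
      fun x hx => triplePlane_pos ha hb hc h1 h2 h3 hx
  rw [h.2.1] at h4
  simp at h4

end Triple

end PseudoHyperbolic
end

noncomputable section

namespace PseudoHyperbolic

variable {E : Type*} [NormedAddCommGroup E] [NormedSpace ℝ E] {Q : QuadraticForm ℝ E}

/-! ### The asymptotic boundary of an entire graph -/

/-- A map to the pseudo-hyperbolic space whose image is an entire acausal graph over a positive
definite plane, in coordinates. -/
structure AcausalGraph {S : Type*} (f : S → PseudoHyp Q) (n : ℕ) where
  L : E ≃L[ℝ] R2 × EuclideanSpace ℝ (Fin (n + 1))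
  form_eq : ∀ x, Q x = ‖(L x).1‖ ^ 2 - ‖(L x).2‖ ^ 2
  scal_le : ∀ s t, scal Q (f s : E) (f t) ≤ -1
  surj : ∀ p, ∃ s, (L (f s)).1 = p
  nondeg : ∀ g : E, g ≠ 0 → Q g = 0 → ∃ s, scal Q g (f s) ≠ 0

namespace AcausalGraph

open Set Filter

variable {S : Type*} {f : S → PseudoHyp Q} {n : ℕ} (D : AcausalGraph f n)

/-- The norm of the negative definite component. -/
def height (s : S) : ℝ := ‖(D.L (f s)).2‖

theorem height_sq (s : S) : D.height s ^ 2 = 1 + ‖(D.L (f s)).1‖ ^ 2 := by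
  have h : Q (f s : E) = -1 := (f s).2
  rw [D.form_eq] at h
  rw [height]
  linarith

theorem height_pos (s : S) : 0 < D.height s := by
  refine (norm_nonneg _).lt_of_ne ?_
  intro h
  have h1 := D.height_sq s
  rw [height, ← h] at h1
  nlinarith [sq_nonneg ‖(D.L (f s)).1‖]

/-- The representative of the ray of `f s` in the product of the closed unit disk and the unit
sphere. -/
def unitPoint (s : S) : E := (D.height s)⁻¹ • (f s : E)

theorem unitPoint_eq (s : S) : D.unitPoint s = (D.height s)⁻¹ • (f s : E) := rfl

theorem form_unitPoint (s : S) : Q (D.unitPoint s) = -(D.height s)⁻¹ ^ 2 := by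
  rw [unitPoint_eq, map_smul_eq, show Q (f s : E) = -1 from (f s).2]
  ring

/-- The closure of the set of unit points. -/
def hull : Set E := closure (range D.unitPoint)

theorem norm_snd_of_mem_hull {g : E} (hg : g ∈ D.hull) : ‖(D.L g).2‖ = 1 := by
  have hcl : IsClosed {g : E | ‖(D.L g).2‖ = 1} :=
    isClosed_eq (by fun_prop) continuous_const
  refine closure_minimal ?_ hcl hg
  rintro _ ⟨s, rfl⟩
  have h := D.height_pos s
  change ‖(D.L (D.unitPoint s)).2‖ = 1
  rw [unitPoint_eq, map_smul, Prod.smul_snd, norm_smul, norm_inv, Real.norm_of_nonneg h.le]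
  exact inv_mul_cancel₀ h.ne'

theorem form_eq_of_mem_hull {g : E} (hg : g ∈ D.hull) : Q g = ‖(D.L g).1‖ ^ 2 - 1 := by
  rw [D.form_eq, D.norm_snd_of_mem_hull hg, one_pow]

theorem ne_zero_of_mem_hull {g : E} (hg : g ∈ D.hull) : g ≠ 0 := by
  rintro rfl
  have := D.norm_snd_of_mem_hull hg
  simp at this


theorem form_nonpos_of_mem_hull [FiniteDimensional ℝ E] {g : E} (hg : g ∈ D.hull) : Q g ≤ 0 := by
  have hcl : IsClosed {g : E | Q g ≤ 0} := isClosed_le (continuous_form Q) continuous_const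
  refine closure_minimal ?_ hcl hg
  rintro _ ⟨s, rfl⟩
  change Q _ ≤ 0
  rw [form_unitPoint]
  have := sq_nonneg (D.height s)⁻¹
  linarith

/-- At unit points this is `⟨f s, f t⟩ ≤ -1` divided by both heights. Writing the inverse height as
`√(-Q)` turns it into a closed condition, which survives in the closure. -/
theorem scal_le_of_mem_hull [FiniteDimensional ℝ E] {g g' : E} (hg : g ∈ D.hull)
    (hg' : g' ∈ D.hull) :
    scal Q g g' ≤ -(√(-Q g) * √(-Q g')) := by
  have hcl : IsClosed {p : E × E | scal Q p.1 p.2 ≤ -(√(-Q p.1) * √(-Q p.2))} := by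
    refine isClosed_le (continuous_scal continuous_fst continuous_snd) ?_
    have h1 : Continuous fun p : E × E => Q p.1 := (continuous_form Q).comp continuous_fst
    have h2 : Continuous fun p : E × E => Q p.2 := (continuous_form Q).comp continuous_snd
    exact (h1.neg.sqrt.mul h2.neg.sqrt).neg
  have hsub : range D.unitPoint ×ˢ range D.unitPoint ⊆
      {p : E × E | scal Q p.1 p.2 ≤ -(√(-Q p.1) * √(-Q p.2))} := by
    rintro ⟨_, _⟩ ⟨⟨s, rfl⟩, ⟨t, rfl⟩⟩
    have hs := inv_pos.2 (D.height_pos s)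
    have ht := inv_pos.2 (D.height_pos t)
    simp only [mem_ofPred_eq, form_unitPoint, neg_neg, Real.sqrt_sq hs.le, Real.sqrt_sq ht.le]
    rw [unitPoint_eq, unitPoint_eq]
    simp only [map_smul, LinearMap.smul_apply, smul_eq_mul]
    nlinarith [mul_pos hs ht, D.scal_le s t]
  have hmem : (g, g') ∈ closure (range D.unitPoint ×ˢ range D.unitPoint) := by
    rw [closure_prod_eq]
    exact ⟨hg, hg'⟩
  have h := hcl.closure_subset_iff.2 hsub hmem
  rwa [mem_ofPred_eq] at h

theorem scal_nonpos_of_mem_hull [FiniteDimensional ℝ E] {g : E} (hg : g ∈ D.hull) (s : S) :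
    scal Q g (f s) ≤ 0 := by
  have h1 := D.scal_le_of_mem_hull hg (subset_closure (mem_range_self s))
  have h2 : (f s : E) = D.height s • D.unitPoint s := by
    rw [unitPoint_eq, smul_inv_smul₀ (D.height_pos s).ne']
  rw [h2, map_smul, smul_eq_mul]
  refine mul_nonpos_of_nonneg_of_nonpos (D.height_pos s).le (h1.trans ?_)
  have : 0 ≤ √(-Q g) * √(-Q (D.unitPoint s)) := by positivity
  linarith

/-- `Q` is negative definite on the vectors with zero first component. This is the source of the
vector identities below. -/
theorem eq_of_form_sub_nonneg {x : E} (h1 : (D.L x).1 = 0) (h2 : 0 ≤ Q x) : x = 0 := by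
  rw [D.form_eq, h1] at h2
  have h3 : (D.L x).2 = 0 := by
    have : ‖(D.L x).2‖ = 0 := by
      simp only [norm_zero] at h2
      nlinarith [norm_nonneg (D.L x).2]
    exact norm_eq_zero.1 this
  exact D.L.map_eq_zero_iff.1 (Prod.ext h1 h3)

/-- The hull is a graph over the closed disk. -/
theorem eq_of_fst_eq [FiniteDimensional ℝ E] {g g' : E} (hg : g ∈ D.hull) (hg' : g' ∈ D.hull)
    (h : (D.L g).1 = (D.L g').1) : g = g' := by
  refine sub_eq_zero.1 (D.eq_of_form_sub_nonneg ?_ ?_)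
  · rw [map_sub, Prod.fst_sub, h, sub_self]
  · have h1 : Q g = Q g' := by rw [D.form_eq_of_mem_hull hg, D.form_eq_of_mem_hull hg', h]
    have h2 := D.scal_le_of_mem_hull hg hg'
    have h3 := D.form_nonpos_of_mem_hull hg'
    rw [h1, Real.mul_self_sqrt (by linarith)] at h2
    rw [map_sub_eq, h1]
    linarith

theorem isCompact_hull [FiniteDimensional ℝ E] : IsCompact D.hull := by
  refine IsCompact.of_isClosed_subset
    (D.L.toHomeomorph.isCompact_preimage.2 (isCompact_closedBall (0 : R2 × _) 1))
    isClosed_closure fun g hg => ?_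
  change D.L g ∈ Metric.closedBall 0 1
  rw [mem_closedBall_zero_iff, Prod.norm_def]
  refine max_le ?_ (D.norm_snd_of_mem_hull hg).le
  have h1 := D.form_nonpos_of_mem_hull hg
  rw [D.form_eq_of_mem_hull hg] at h1
  exact (sq_le_one_iff₀ (norm_nonneg _)).1 (by linarith)

theorem exists_mem_hull [FiniteDimensional ℝ E] {u : R2} (hu : ‖u‖ ≤ 1) : ∃ g ∈ D.hull,
    (D.L g).1 = u := by
  have hclosed : IsClosed ((fun g => (D.L g).1) '' D.hull) :=
    (D.isCompact_hull.image (by fun_prop)).isClosed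
  have hball : Metric.ball (0 : R2) 1 ⊆ (fun g => (D.L g).1) '' D.hull := by
    intro z hz
    rw [mem_ball_zero_iff] at hz
    have h0 : 0 < 1 - ‖z‖ ^ 2 := by nlinarith [norm_nonneg z]
    have hs := Real.sqrt_pos.2 h0
    have hs2 := Real.sq_sqrt h0.le
    -- A point with this first component has height `(√(1 - ‖z‖ ^ 2))⁻¹`, so rescaling brings the
    -- component back to `z`. The boundary of the disk is then reached by compactness.
    obtain ⟨s, hs'⟩ := D.surj ((√(1 - ‖z‖ ^ 2))⁻¹ • z)
    refine ⟨_, subset_closure (mem_range_self s), ?_⟩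
    have hh : D.height s = (√(1 - ‖z‖ ^ 2))⁻¹ := by
      rw [← pow_left_inj₀ (D.height_pos s).le (by positivity) two_ne_zero, D.height_sq, hs',
        norm_smul, norm_inv, Real.norm_of_nonneg hs.le, mul_pow, inv_pow, hs2]
      field_simp
      ring
    change (D.L (D.unitPoint s)).1 = z
    rw [unitPoint_eq, map_smul, Prod.smul_fst, hs', hh, inv_inv, smul_inv_smul₀ hs.ne']
  have hsub := hclosed.closure_subset_iff.2 hball
  rw [closure_ball _ one_ne_zero] at hsub
  exact hsub (mem_closedBall_zero_iff.2 hu)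

/-- The isotropic part of the hull. -/
def limitSet : Set E := {g | g ∈ D.hull ∧ Q g = 0}

theorem norm_fst_of_mem_limitSet {g : E} (hg : g ∈ D.limitSet) : ‖(D.L g).1‖ = 1 := by
  have h1 := hg.2
  rw [D.form_eq_of_mem_hull hg.1] at h1
  exact (pow_eq_one_iff_of_nonneg (norm_nonneg _) two_ne_zero).1 (by linarith)

theorem scal_nonpos [FiniteDimensional ℝ E] {g g' : E} (hg : g ∈ D.limitSet)
    (hg' : g' ∈ D.limitSet) :
    scal Q g g' ≤ 0 := by
  have := D.scal_le_of_mem_hull hg.1 hg'.1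
  simpa [hg.2] using this

theorem isCompact_limitSet [FiniteDimensional ℝ E] : IsCompact D.limitSet :=
  D.isCompact_hull.inter_right (isClosed_eq (continuous_form Q) continuous_const)

/-- The identification of the complex plane with the model plane. -/
def complexEquiv : ℂ ≃ₗᵢ[ℝ] R2 := Complex.orthonormalBasisOneI.repr

/-- The projection of the limit set to the circle. -/
def toCircle (g : D.limitSet) : Circle :=
  ⟨complexEquiv.symm (D.L g.1).1, by
    refine mem_sphere_zero_iff_norm.2 ?_
    rw [LinearIsometryEquiv.norm_map]
    exact D.norm_fst_of_mem_limitSet g.2⟩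

theorem complexEquiv_toCircle (g : D.limitSet) :
    complexEquiv (D.toCircle g : ℂ) = (D.L g.1).1 := complexEquiv.apply_symm_apply _

theorem continuous_toCircle : Continuous D.toCircle := by
  refine Continuous.subtype_mk ?_ _
  exact complexEquiv.symm.continuous.comp
    (continuous_fst.comp (D.L.continuous.comp continuous_subtype_val))

theorem bijective_toCircle [FiniteDimensional ℝ E] : Function.Bijective D.toCircle := by
  constructor
  · intro g g' h
    refine Subtype.ext (D.eq_of_fst_eq g.2.1 g'.2.1 ?_)
    rw [← D.complexEquiv_toCircle, h, D.complexEquiv_toCircle]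
  · intro z
    have hz : ‖complexEquiv (z : ℂ)‖ = 1 := by
      rw [LinearIsometryEquiv.norm_map, Circle.norm_coe]
    obtain ⟨g, hg, hgz⟩ := D.exists_mem_hull hz.le
    have hQ : Q g = 0 := by rw [D.form_eq_of_mem_hull hg, hgz, hz]; norm_num
    refine ⟨⟨g, hg, hQ⟩, Circle.ext (complexEquiv.injective ?_)⟩
    rw [D.complexEquiv_toCircle]
    exact hgz

/-- The limit set is a topological circle. -/
def circleHomeo [FiniteDimensional ℝ E] : D.limitSet ≃ₜ Circle :=
  haveI : CompactSpace D.limitSet := isCompact_iff_compactSpace.1 D.isCompact_limitSet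
  Continuous.homeoOfEquivCompactToT2 (f := Equiv.ofBijective _ D.bijective_toCircle)
    D.continuous_toCircle

/-- The parametrization of the limit set by the angle. -/
def param [FiniteDimensional ℝ E] (θ : ℝ) : E := D.circleHomeo.symm (Circle.exp θ)

theorem continuous_param [FiniteDimensional ℝ E] : Continuous D.param :=
  continuous_subtype_val.comp (D.circleHomeo.symm.continuous.comp Circle.exp.continuous)

theorem param_mem [FiniteDimensional ℝ E] (θ : ℝ) : D.param θ ∈ D.limitSet :=
    (D.circleHomeo.symm _).2

theorem fst_param [FiniteDimensional ℝ E] (θ : ℝ) : (D.L (D.param θ)).1 = complexEquiv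
    (Complex.exp (θ * Complex.I)) := by
  rw [← Circle.coe_exp]
  have h : D.toCircle (D.circleHomeo.symm (Circle.exp θ)) = Circle.exp θ :=
    D.circleHomeo.apply_symm_apply _
  rw [← h, D.complexEquiv_toCircle]
  rfl

theorem param_congr [FiniteDimensional ℝ E] {θ θ' : ℝ} (h : Circle.exp θ = Circle.exp θ') :
    D.param θ = D.param θ' := by
  rw [param, h, param]

theorem exists_scal_neg [FiniteDimensional ℝ E] {g : E} (hg : g ∈ D.limitSet) : ∃ s, scal Q g
    (f s) < 0 := by
  obtain ⟨s, hs⟩ := D.nondeg g (D.ne_zero_of_mem_hull hg.1) hg.2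
  exact ⟨s, (D.scal_nonpos_of_mem_hull hg.1 s).lt_of_ne hs⟩

/-- If the product vanished, the sum of the two vectors would be isotropic with zero first
component, hence zero. Opposite vectors cannot both have nonpositive product with every `f s` unless
these products all vanish. -/
theorem scal_antipode_neg [FiniteDimensional ℝ E] (θ : ℝ) : scal Q (D.param θ)
    (D.param (θ + Real.pi)) < 0 := by
  refine (D.scal_nonpos (D.param_mem _) (D.param_mem _)).lt_of_ne fun h => ?_
  have h1 : D.param θ + D.param (θ + Real.pi) = 0 := by
    refine D.eq_of_form_sub_nonneg ?_ ?_
    · rw [map_add, Prod.fst_add, fst_param, fst_param, ← map_add]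
      push_cast
      rw [add_mul, Complex.exp_add, Complex.exp_pi_mul_I]
      simp
    · rw [map_add_eq, h, (D.param_mem _).2, (D.param_mem _).2]
      simp
  obtain ⟨s, hs⟩ := D.exists_scal_neg (D.param_mem θ)
  have h2 := D.scal_nonpos_of_mem_hull (D.param_mem (θ + Real.pi)).1 s
  rw [eq_neg_of_add_eq_zero_right h1, map_neg, LinearMap.neg_apply] at h2
  linarith

/-- Three mutually orthogonal equally spaced points of the limit set satisfy the recurrence relation
of the cosine. -/
theorem param_recurrence [FiniteDimensional ℝ E] {θ δ : ℝ}
    (h1 : scal Q (D.param θ) (D.param (θ + δ)) = 0)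
    (h2 : scal Q (D.param θ) (D.param (θ + δ + δ)) = 0)
    (h3 : scal Q (D.param (θ + δ)) (D.param (θ + δ + δ)) = 0) :
    D.param θ + D.param (θ + δ + δ) = (2 * Real.cos δ) • D.param (θ + δ) := by
  refine sub_eq_zero.1 ?_
  have he : D.param θ + D.param (θ + δ + δ) - (2 * Real.cos δ) • D.param (θ + δ) =
      (1 : ℝ) • D.param θ + (-(2 * Real.cos δ)) • D.param (θ + δ) +
        (1 : ℝ) • D.param (θ + δ + δ) := by
    module
  -- The first component vanishes by the addition formula for the exponential, and the combination
  -- is isotropic because all pairwise products are zero.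
  refine D.eq_of_form_sub_nonneg ?_ ?_
  · simp only [map_sub, map_add, map_smul, Prod.fst_sub, Prod.fst_add, Prod.smul_fst, fst_param]
    rw [← map_smul, ← map_add, ← map_sub]
    have : Complex.exp (θ * Complex.I) + Complex.exp (((θ + δ + δ : ℝ) : ℂ) * Complex.I) -
        (2 * Real.cos δ) • Complex.exp (((θ + δ : ℝ) : ℂ) * Complex.I) = 0 := by
      rw [Complex.real_smul]
      push_cast
      rw [Complex.cos]
      have e1 : Complex.exp (((θ : ℂ) + δ + δ) * Complex.I) =
          Complex.exp (((θ : ℂ) + δ) * Complex.I) * Complex.exp (δ * Complex.I) := by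
        rw [← Complex.exp_add]; congr 1; ring
      have e2 : Complex.exp ((θ : ℂ) * Complex.I) =
          Complex.exp (((θ : ℂ) + δ) * Complex.I) * Complex.exp (-δ * Complex.I) := by
        rw [← Complex.exp_add]; congr 1; ring
      rw [e1, e2]
      ring
    rw [this, map_zero]
  · rw [he, map_combo_of_isotropic (D.param_mem _).2 (D.param_mem _).2 (D.param_mem _).2, h1, h2,
      h3]
    simp

/-- The limit set contains three points with negative pairwise products. -/
theorem exists_scal_neg_triple [FiniteDimensional ℝ E] :
    ∃ a ∈ D.limitSet, ∃ b ∈ D.limitSet, ∃ c ∈ D.limitSet,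
    scal Q a b < 0 ∧ scal Q a c < 0 ∧ scal Q b c < 0 := by
  by_contra! hno
  -- Two points near `θ` both have negative product with the antipode of `θ`. In the absence of a
  -- negative triple of products, they are orthogonal to each other.
  have hloc (θ : ℝ) : ∃ ε > 0, ∀ α ∈ Metric.ball θ ε, ∀ β ∈ Metric.ball θ ε,
      scal Q (D.param α) (D.param β) = 0 := by
    have hc : Continuous fun α => scal Q (D.param α) (D.param (θ + Real.pi)) :=
      continuous_scal D.continuous_param continuous_const
    obtain ⟨ε, hε, hball⟩ := Metric.mem_nhds_iff.1
      (hc.continuousAt.eventually (gt_mem_nhds (D.scal_antipode_neg θ)))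
    refine ⟨ε, hε, fun α hα β hβ => ?_⟩
    refine le_antisymm (D.scal_nonpos (D.param_mem _) (D.param_mem _)) ?_
    by_contra! hlt
    exact absurd (hno _ (D.param_mem α) _ (D.param_mem β) _ (D.param_mem (θ + Real.pi)) hlt
      (hball hα)) (not_le.2 (hball hβ))
  choose ε hε hnull using hloc
  obtain ⟨δ, hδ, hleb⟩ := lebesgue_number_lemma_of_metric
    (isCompact_Icc (a := (0 : ℝ)) (b := 2 * Real.pi)) (c := fun θ => Metric.ball θ (ε θ))
    (fun θ => Metric.isOpen_ball) (fun θ _ => mem_iUnion.2 ⟨θ, Metric.mem_ball_self (hε θ)⟩)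
  -- The bound `4π / δ` makes two steps of size `τ = 2π / N` shorter than the Lebesgue number; the
  -- extra `1` gives `N > 1`, hence `0 < τ < 2π` and `cos τ ≠ 1`.
  obtain ⟨N, hN⟩ := exists_nat_gt (4 * Real.pi / δ + 1)
  have hpi := Real.pi_pos
  have hN1 : (1 : ℝ) < N := lt_of_le_of_lt (le_add_of_nonneg_left (by positivity)) hN
  have hN0 : (0 : ℝ) < N := zero_lt_one.trans hN1
  set τ : ℝ := 2 * Real.pi / N with hτ
  have hτ0 : 0 < τ := by positivity
  have hτδ : 2 * τ < δ := by
    rw [hτ, ← mul_div_assoc, div_lt_iff₀ hN0]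
    have hN' : 4 * Real.pi / δ < N := by linarith
    rw [div_lt_iff₀ hδ] at hN'
    linarith
  let a : ℕ → E := fun k => D.param (k * τ)
  have hrec (k : ℕ) (hk : k < N) : a k + a (k + 2) = (2 * Real.cos τ) • a (k + 1) := by
    have hkN : (k : ℝ) ≤ N := by exact_mod_cast hk.le
    have hkτ : (k * τ : ℝ) ∈ Icc 0 (2 * Real.pi) := by
      refine ⟨by positivity, ?_⟩
      rw [hτ, ← mul_div_assoc, div_le_iff₀ hN0]
      nlinarith
    obtain ⟨θ, hθ⟩ := hleb _ hkτ
    have m0 : (k * τ : ℝ) ∈ Metric.ball θ (ε θ) := hθ (Metric.mem_ball_self hδ)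
    have m1 : (k * τ + τ : ℝ) ∈ Metric.ball θ (ε θ) := hθ (by
      rw [Metric.mem_ball, Real.dist_eq, add_sub_cancel_left, abs_of_pos hτ0]; linarith)
    have m2 : (k * τ + τ + τ : ℝ) ∈ Metric.ball θ (ε θ) := hθ (by
      rw [Metric.mem_ball, Real.dist_eq, abs_lt]; constructor <;> linarith)
    have e1 : a (k + 1) = D.param (k * τ + τ) := by
      simp only [a]; congr 1; push_cast; ring
    have e2 : a (k + 2) = D.param (k * τ + τ + τ) := by
      simp only [a]; congr 1; push_cast; ring
    rw [e1, e2]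
    exact D.param_recurrence (hnull θ _ m0 _ m1) (hnull θ _ m0 _ m2) (hnull θ _ m1 _ m2)
  have hper (k : ℕ) : a (N + k) = a k := by
    refine D.param_congr ?_
    have : ((N + k : ℕ) : ℝ) * τ = k * τ + 2 * Real.pi := by
      push_cast
      rw [hτ]
      field_simp
      ring
    rw [this]
    exact Circle.periodic_exp _
  have hshift (m : ℕ) : ∑ k ∈ Finset.range N, a (k + m) = ∑ k ∈ Finset.range N, a k := by
    induction m with
    | zero => rfl
    | succ m ih =>
      rw [← ih]
      have h1 := Finset.sum_range_succ (fun k => a (k + m)) N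
      have h2 := Finset.sum_range_succ' (fun k => a (k + m)) N
      rw [h1, hper m, zero_add] at h2
      have h3 := add_right_cancel h2
      rw [h3]
      refine Finset.sum_congr rfl fun k _ => ?_
      congr 1
      ring
  set A := ∑ k ∈ Finset.range N, a k with hA
  -- Sum of the recurrences over one full turn, the sum of the points being invariant under shifts
  -- of the index.
  have hsum : A + A = (2 * Real.cos τ) • A := by
    nth_rewrite 2 [← hshift 2]
    nth_rewrite 2 [← hshift 1]
    rw [hA, Finset.smul_sum, ← Finset.sum_add_distrib]
    exact Finset.sum_congr rfl fun k hk => hrec k (Finset.mem_range.1 hk)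
  have hN2 : τ < 2 * Real.pi := div_lt_self (by positivity) hN1
  have hcos : Real.cos τ ≠ 1 := by
    intro h
    have := (Real.cos_eq_one_iff_of_lt_of_lt (by linarith) hN2).1 h
    exact hτ0.ne' this
  have hzero : A = 0 := by
    have h1 : (2 * (1 - Real.cos τ)) • A = 0 := by
      rw [mul_sub, sub_smul, ← hsum]
      module
    refine (smul_eq_zero.1 h1).resolve_left ?_
    intro h2
    exact hcos (by linarith)
  -- `A = 0` is absurd: pairing it with this `f s` gives a sum of nonpositive terms whose term of
  -- index `0` is negative.
  obtain ⟨s, hs⟩ := D.exists_scal_neg (D.param_mem ((0 : ℕ) * τ))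
  have h1 : ∑ k ∈ Finset.range N, scal Q (a k) (f s) = 0 := by
    have : scal Q A (f s) = 0 := by rw [hzero]; simp
    rw [hA, map_sum, LinearMap.sum_apply] at this
    exact this
  have h2 := (Finset.sum_eq_zero_iff_of_nonpos (s := Finset.range N)
    fun k _ => D.scal_nonpos_of_mem_hull (D.param_mem (k * τ)).1 s).1 h1 0
    (Finset.mem_range.2 (by exact_mod_cast hN0))
  exact hs.ne h2

end AcausalGraph

end PseudoHyperbolic
end

noncomputable section

namespace PseudoHyperbolic

variable {E : Type*} [NormedAddCommGroup E] [NormedSpace ℝ E] {Q : QuadraticForm ℝ E}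

/-! ### The asymptotic boundary as the set of rays over the limit set. -/

namespace AcausalGraph

open Set Filter

variable {S : Type*} {f : S → PseudoHyp Q} {n : ℕ} (D : AcausalGraph f n)

/-- The ray spanned by a point of the hull. -/
def ray (g : D.hull) : Module.Ray ℝ E := rayOfNeZero ℝ g.1 (D.ne_zero_of_mem_hull g.2)

theorem continuous_ray : Continuous D.ray :=
  continuous_rayOfNeZero.comp
    (continuous_subtype_val.subtype_mk fun g : D.hull => D.ne_zero_of_mem_hull g.2)

theorem ray_injective : Function.Injective D.ray := by
  intro g g' h
  obtain ⟨c, hc, hcg⟩ := exists_pos_smul_of_ray_eq h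
  have h1 := D.norm_snd_of_mem_hull g'.2
  rw [hcg, map_smul, Prod.smul_snd, norm_smul, D.norm_snd_of_mem_hull g.2, mul_one,
    Real.norm_of_nonneg hc.le] at h1
  rw [h1, one_smul] at hcg
  exact Subtype.ext hcg.symm

theorem ray_unitPoint (s : S) :
    D.ray ⟨D.unitPoint s, subset_closure (mem_range_self s)⟩ = toRay Q (f s) := by
  rw [ray, toRay, ray_eq_iff]
  exact SameRay.sameRay_pos_smul_left _ (inv_pos.2 (D.height_pos s))

/-- The rays of the compact hull form a closed set, in which the rays of the surface are dense. -/
theorem closure_image_toRay [FiniteDimensional ℝ E] : closure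
    (toRay Q '' range f) = range D.ray := by
  apply Subset.antisymm
  · have : CompactSpace D.hull := isCompact_iff_compactSpace.1 D.isCompact_hull
    refine closure_minimal ?_ (isCompact_range D.continuous_ray).isClosed
    rintro _ ⟨_, ⟨s, rfl⟩, rfl⟩
    exact ⟨_, D.ray_unitPoint s⟩
  · rintro _ ⟨g, rfl⟩
    have hg : g ∈ closure {g : D.hull | g.1 ∈ range D.unitPoint} := by
      rw [closure_subtype]
      refine closure_mono ?_ g.2
      rintro _ ⟨s, rfl⟩
      exact ⟨⟨D.unitPoint s, subset_closure (mem_range_self s)⟩, ⟨s, rfl⟩, rfl⟩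
    refine map_mem_closure D.continuous_ray hg ?_
    rintro ⟨_, hh⟩ ⟨s, rfl⟩
    exact ⟨f s, mem_range_self s, (D.ray_unitPoint s).symm⟩

theorem toRay_notMem_infinity (x : PseudoHyp Q) : toRay Q x ∉ infinity Q := by
  rintro ⟨v, hv, hQ, h⟩
  obtain ⟨c, hc, rfl⟩ := exists_pos_smul_of_ray_eq h
  have hx : Q (x : E) = -1 := x.2
  rw [map_smul_eq, hx] at hQ
  nlinarith [sq_pos_of_pos hc]

theorem ray_mem_infinity_iff (g : D.hull) : D.ray g ∈ infinity Q ↔ Q (g : E) = 0 := by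
  constructor
  · rintro ⟨v, hv, hQ, h⟩
    obtain ⟨c, hc, rfl⟩ := exists_pos_smul_of_ray_eq h
    rw [map_smul_eq] at hQ
    exact (mul_eq_zero.1 hQ).resolve_left (by positivity)
  · intro h
    exact ⟨g, D.ne_zero_of_mem_hull g.2, h, rfl⟩

/-- The ray spanned by a point of the limit set. -/
def limitRay (g : D.limitSet) : Module.Ray ℝ E := D.ray ⟨g.1, g.2.1⟩

theorem asymptoticBoundary_eq [FiniteDimensional ℝ E] : asymptoticBoundary Q
    (range f) = range D.limitRay := by
  ext r
  constructor
  · rintro ⟨⟨⟨h1, -⟩, -⟩, h2⟩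
    rw [D.closure_image_toRay] at h1
    obtain ⟨g, rfl⟩ := h1
    exact ⟨⟨g.1, g.2, (D.ray_mem_infinity_iff g).1 h2⟩, rfl⟩
  · rintro ⟨g, rfl⟩
    have h1 : D.limitRay g ∈ infinity Q := (D.ray_mem_infinity_iff _).2 g.2.2
    refine ⟨⟨⟨?_, Or.inr h1⟩, ?_⟩, h1⟩
    · rw [D.closure_image_toRay]
      exact mem_range_self _
    · rintro ⟨x, -, hx⟩
      rw [← hx] at h1
      exact toRay_notMem_infinity x h1

theorem limitRay_injective : Function.Injective D.limitRay := by
  intro g g' h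
  exact Subtype.ext (Subtype.mk.inj (D.ray_injective h))

theorem continuous_limitRay : Continuous D.limitRay :=
  D.continuous_ray.comp (continuous_subtype_val.subtype_mk _)

theorem raySpan_limitRay (a b c : D.limitSet) :
    raySpan {D.limitRay a, D.limitRay b, D.limitRay c} = Submodule.span ℝ {a.1, b.1, c.1} :=
  raySpan_triple _ _ _

/-- The asymptotic boundary of an entire acausal graph is a semi-positive loop. -/
theorem isSemiPositiveLoop [FiniteDimensional ℝ E] (D : AcausalGraph f n) :
    IsSemiPositiveLoop Q (asymptoticBoundary Q (range f)) := by
  refine ⟨fun r hr => Or.inr hr.2, ?_, ?_, ?_⟩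
  · rw [D.asymptoticBoundary_eq]
    have : CompactSpace D.limitSet := isCompact_iff_compactSpace.1 D.isCompact_limitSet
    have h : Continuous (Equiv.ofInjective _ D.limitRay_injective) :=
      D.continuous_limitRay.subtype_mk _
    exact ⟨(Continuous.homeoOfEquivCompactToT2 h).symm.trans D.circleHomeo⟩
  · rw [D.asymptoticBoundary_eq]
    rintro ⟨_, ⟨a, rfl⟩, _, ⟨b, rfl⟩, _, ⟨c, rfl⟩, -, -, -, h⟩
    rw [raySpan_limitRay] at h
    exact not_hasSignature_one_two a.2.2 b.2.2 c.2.2 (D.scal_nonpos a.2 b.2)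
      (D.scal_nonpos a.2 c.2) (D.scal_nonpos b.2 c.2) h
  · rw [D.asymptoticBoundary_eq]
    obtain ⟨a, ha, b, hb, c, hc, hab, hac, hbc⟩ := D.exists_scal_neg_triple
    have hne {x y : D.limitSet} (h : scal Q x.1 y.1 < 0) : D.limitRay x ≠ D.limitRay y := by
      intro he
      rw [D.limitRay_injective he, scal_self, y.2.2] at h
      exact lt_irrefl _ h
    refine ⟨_, ⟨⟨a, ha⟩, rfl⟩, _, ⟨⟨b, hb⟩, rfl⟩, _, ⟨⟨c, hc⟩, rfl⟩, hne hab, hne hac, hne hbc, ?_⟩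
    rw [raySpan_limitRay]
    exact hasSignature_two_one ha.2 hb.2 hc.2 hab hac hbc

end AcausalGraph

variable {S : Type*} [TopologicalSpace S] [ChartedSpace (EuclideanSpace ℝ (Fin 2)) S]
  [IsManifold (𝓡 2) ∞ S] [ConnectedSpace S] {f : S → PseudoHyp Q}

/-- An entire graph is an acausal graph over any of its tangent planes. -/
theorem IsEntireGraph.nonempty_acausalGraph [FiniteDimensional ℝ E] {n : ℕ}
    (hQ : HasSignature Q ⊤ 2 (n + 1))
    (hf : IsSpacelikeImmersion Q f) (h : IsEntireGraph Q f) : Nonempty (AcausalGraph f n) := by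
  obtain ⟨s₀⟩ : Nonempty S := inferInstance
  obtain ⟨p⟩ := hf.exists_localParam s₀
  set P := p.tangentPlane with hPdef
  obtain ⟨L, hL, hP⟩ := P.exists_coord hQ
  refine ⟨⟨L, hL, h.projInjective.scal_le hf, fun v => ?_, fun g hg hQg => ?_⟩⟩
  · have hu : L.symm (v, 0) ∈ P.U := by
      have h1 := P.projU_mem (L.symm (v, 0))
      rw [hP, L.apply_symm_apply] at h1
      exact h1
    obtain ⟨-, -, ψ, -, -, hψ⟩ := h P
    refine ⟨ψ (L.symm (v, 0) + √(1 + Q (L.symm (v, 0))) • P.q), ?_⟩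
    have h1 := hψ _ (P.mem_plane_iff.2 ⟨_, hu, rfl⟩)
    have h2 := congrArg P.projU h1
    rw [P.projU_warpedProj, map_add, map_smul, P.projU_q, smul_zero, add_zero,
      P.projU_of_mem_U hu, hP] at h2
    exact congrArg Prod.fst (L.symm.injective h2)
  -- A vector orthogonal to the whole surface is orthogonal to its tangent plane at `s₀`, so it lies
  -- in the negative definite space `W` and cannot be isotropic unless it is zero.
  · by_contra! hall
    have hext : IsLocalExtr (fun t => scal Q g (f t)) s₀ := by
      refine Or.inl (Filter.Eventually.of_forall fun t => ?_)
      simp only [hall, le_refl]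
    have hW : g ∈ P.W := p.mem_tangentPlane_W (p.scal_deriv_eq_zero_of_isLocalExtr hext)
    exact (P.neg_of_mem_W hQ hW hg).ne hQg

end PseudoHyperbolic

end

theorem propositionp
    {E : Type*} [NormedAddCommGroup E] [NormedSpace ℝ E] [FiniteDimensional ℝ E]
    (n : ℕ) (Q : QuadraticForm ℝ E)
    (hQ : PseudoHyperbolic.HasSignature Q ⊤ 2 (n + 1))
    {S : Type*} [TopologicalSpace S] [T2Space S] [SecondCountableTopology S]
    [ChartedSpace (EuclideanSpace ℝ (Fin 2)) S] [IsManifold (𝓡 2) ∞ S]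
    [SimplyConnectedSpace S]
    (f : S → PseudoHyperbolic.PseudoHyp Q)
    (hf : PseudoHyperbolic.IsSpacelikeImmersion Q f) :
    (IsProperMap f ∨ PseudoHyperbolic.IsCompleteInduced Q f →
      PseudoHyperbolic.IsEntireGraph Q f) ∧
    (PseudoHyperbolic.IsEntireGraph Q f →
      PseudoHyperbolic.IsAcausalSet Q (Set.range f)) ∧
    (PseudoHyperbolic.IsEntireGraph Q f →
      ∀ A : Set (PseudoHyperbolic.PseudoHyp Q),
        PseudoHyperbolic.IsTimelikeSphere Q A → ∃! s : S, f s ∈ A) ∧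
    (PseudoHyperbolic.IsEntireGraph Q f →
      PseudoHyperbolic.IsSemiPositiveLoop Q
        (PseudoHyperbolic.asymptoticBoundary Q (Set.range f))) := by
  refine ⟨fun h => hf.isEntireGraph hQ h, fun h => h.projInjective.isAcausalSet hf,
    fun h A hA => h.existsUnique_mem hA, fun h => ?_⟩
  obtain ⟨D⟩ := h.nonempty_acausalGraph hQ hf
  exact D.isSemiPositiveLoop
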